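/- Fix a finite set $C\subseteq\mathbb N$ and let $Col=C\uplus\{\epsilon\}$, where the neutral colour $\epsilon$ is smaller than every element of $C$. Let $\mathbf{FinScottL}$ be the category whose objects are the finite preordered sets and whose morphisms $A\to B$ are the relations $R\subseteq A\times B$ such that $(a,b)\in R$, $a\le a'$ and $b'\le b$ imply $(a',b')\in R$, with relational composition and identities $\{(a',a)\mid a\le a'\}$. Let $A\otimes B$ be the product preorder, $A\,\&\,B$ the disjoint union (the categorical product), and $A\multimap B=A^{op}\times B$. Let $\square A=Col\times A$, with $(i,a)\le(j,a')$ iff $i=j$ and $a\le a'$, be the colouring comonad, with counit $\{((\epsilon,a),a')\mid a'\le a\}$ and comultiplication $\{((\max(c_1,c_2),a),(c_1,(c_2,a')))\mid a'\le a\}$. Let $!A$ be the comonad of finite subsets of $A$, with $u\le v$ iff every element of $u$ is below some element of $v$; its action on morphisms is $!R=\{(u,v)\mid\forall b\in v\,\exists a\in u,\ (a,b)\in R\}$, its counit is $\{(u,a')\mid\exists a\in u,\ a'\le a\}$ and its comultiplication is $\{(u,U)\mid\forall v\in U,\ v\le u\}$. Write $E={!}\circ\square$ for the composite comonad induced by the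 distributive law ${!}\square A\to\square{!}A$ that relates $u$ to $(c,v)$ iff every $a\in v$ is below some $a'$ with $(c,a')\in u$. Explicitly, $\mathrm{der}:EA\to A$ relates $u$ to $a$ iff $a\le a'$ for some $(\epsilon,a')\in u$, and $\mathrm{dig}:EA\to EEA$ relates $u$ to $U$ iff for all $(c,v)\in U$ and $(d,a)\in v$ there is $(\max(c,d),a')\in u$ with $a\le a'$. For $g:EX\to B$ put $g^\dagger=E(g)\circ\mathrm{dig}:EX\to EB$; let $m:EX\otimes EA\cong E(X\,\&\,A)$ be the Seely isomorphism given by disjoint union, let $\kappa_X=m^{-1}\circ E(\langle \mathrm{id},\mathrm{id}\rangle):EX\to EX\otimes EX$ be contraction, and for $g:EX\otimes EA\to B$ put $g^\dagger=(g\circ m^{-1})^\dagger\circ m:EX\otimes EA\to EB$. Let $R:EX\otimes EA\to A$ and $a\in A$. A semantic run-tree of $R$ producing $a$ is a finitely branching, possibly infinite tree whose nodes are labelled in $X\uplus A$ and coloured in $Col$, whose root has label $a$ and colour $\epsilon$, whose inner nodes have labels in $A$, and such that for every node with label $b\in A$, if $u$ and $v$ are the sets of pairs (colour, label) of its children with label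 in $X$ and in $A$ respectively (both empty when the node is a leaf), then $((u,v),b)\in R$. It is winning if on every infinite branch some element of $C$ occurs infinitely often and the greatest such element is even. Its set of leaves consists of the pairs $(c,x)$ where $x\in X$ is the label of a leaf and $c$ is the maximal colour on the path from this leaf to the root. Define $\mathbf Y_{X,A}(R)$ as the set of pairs $(u,a)$ such that some winning semantic run-tree of $R$ producing $a$ has $u$ as its set of leaves; this is a morphism $EX\to A$. **Proposition.** (1) The operator $\mathbf Y$ is a Conway operator over $\mathbf{FinScottL}$, that is, for all objects $X,Z,A,B$: - (naturality) $\mathbf Y(f\circ(g^\dagger\otimes\mathrm{id}))=\mathbf Y(f)\circ g^\dagger$ for $g:EX\to Z$ and $f:EZ\otimes EA\to A$; - (fixpoint) $\mathbf Y(f)=f\circ(\mathrm{id}\otimes\mathbf Y(f)^\dagger)\circ\kappa_X$ for $f:EX\otimes EA\to A$; - (dinaturality) $\mathbf Y(f\star g)=f\circ(\mathrm{id}\otimes\mathbf Y(g\star f)^\dagger)\circ\kappa_X$ for $f:EX\otimes EB\to A$ and $g:EX\otimes EA\to B$, where $f\star g=f\circ(\mathrm{id}\otimes g^\dagger)\circ(\kappa_X\otimes\mathrm{id})$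 up to associativity, and likewise for $g\star f$; - (diagonal) $\mathbf Y_{X,A}\bigl(\mathbf Y_{X\&A,A}(f\circ(m^{-1}\otimes\mathrm{id}))\circ m\bigr)=\mathbf Y_{X,A}(f\circ(\mathrm{id}\otimes\kappa_A))$, up to associativity, for $f:EX\otimes EA\otimes EA\to A$. (2) On the Kleisli category $\mathbf{FinScottL}_{E}$ of the comonad $E$, which is cartesian closed with products $A\,\&\,B$, terminal object the empty preorder and exponentials $EA\multimap B$, the operator $f\mapsto\mathbf Y(f\circ m)$ is a Conway operator in the usual sense for cartesian categories (naturality in the parameter, and the parametrised fixpoint, dinaturality and diagonal identities). (3) Consequently $\mathbf{FinScottL}_{E}$ is a model of the $\lambda Y$-calculus: for every interpretation of the ground type by an object and of any family of simply-typed constants by global elements of the interpretations of their types, the standard interpretation of simply-typed $\lambda Y$-terms (with $Y_\sigma:(\sigma\to\sigma)\to\sigma$ interpreted by means of $\mathbf Y$) identifies any two terms which are equal in the congruence generated by $\beta$, $\eta$ and $Y_\sigma M=M(Y_\sigma M)$. -/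

import Mathlib

open CategoryTheory MonoidalCategory

universe u v w

/-! ### The category of finite preorders and downward-closed relations -/

/-- An object of `FinScottL`: a finite set with a preorder. -/
structure FinScottL : Type (u + 1) where
  carrier : Type u
  [preorder : Preorder carrier]
  [finite : Finite carrier]

namespace FinScottL

instance : CoeSort FinScottL.{u} (Type u) := ⟨carrier⟩

attribute [instance] preorder finite

/-- A morphism `A ⟶ B`: a relation which is downward closed in `Aᵒᵖ × B`. -/
@[ext]
structure Hom (A B : FinScottL.{u}) where
  rel : A → B → Prop
  down : ∀ {a a' : A} {b b' : B}, rel a b → a ≤ a' → b' ≤ b → rel a' b'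

/-- Identities are `{(a', a) | a ≤ a'}`, and composition is relational composition. -/
instance : Category FinScottL.{u} where
  Hom := Hom
  id _ := ⟨fun a' a => a ≤ a', fun h h₁ h₂ => h₂.trans (h.trans h₁)⟩
  comp R S := ⟨fun a c => ∃ b, R.rel a b ∧ S.rel b c,
    fun ⟨b, h, h'⟩ h₁ h₂ => ⟨b, R.down h h₁ le_rfl, S.down h' le_rfl h₂⟩⟩
  id_comp R := Hom.ext (funext fun a => funext fun _ => propext
    ⟨fun ⟨_, h, h'⟩ => R.down h' h le_rfl, fun h => ⟨a, le_rfl, h⟩⟩)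
  comp_id R := Hom.ext (funext fun _ => funext fun b => propext
    ⟨fun ⟨_, h, h'⟩ => R.down h le_rfl h', fun h => ⟨b, h, le_rfl⟩⟩)
  assoc _ _ _ := Hom.ext (funext fun _ => funext fun _ => propext
    ⟨fun ⟨c, ⟨d, h₁, h₂⟩, h₃⟩ => ⟨d, h₁, c, h₂, h₃⟩,
      fun ⟨d, h₁, c, h₂, h₃⟩ => ⟨c, ⟨d, h₁, h₂⟩, h₃⟩⟩)

theorem hom_ext {A B : FinScottL.{u}} {R S : A ⟶ B} (h : ∀ a b, R.rel a b ↔ S.rel a b) : R = S :=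
  Hom.ext (funext fun a => funext fun b => propext (h a b))

theorem down {A B : FinScottL.{u}} (R : A ⟶ B) {a a' : A} {b b' : B} (h : R.rel a b)
    (ha : a ≤ a') (hb : b' ≤ b) : R.rel a' b' := Hom.down R h ha hb

@[simp] theorem id_rel {A : FinScottL.{u}} (a b : A) : Hom.rel (𝟙 A) a b ↔ b ≤ a := Iff.rfl

@[simp] theorem comp_rel {A B D : FinScottL.{u}} (R : A ⟶ B) (S : B ⟶ D) (a : A) (d : D) :
    Hom.rel (R ≫ S) a d ↔ ∃ b, R.rel a b ∧ S.rel b d := Iff.rfl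

/-- The morphism `{(a, b) | b ≤ f a}` induced by a monotone map `f`. -/
def ofMap {A B : FinScottL.{u}} (f : A →o B) : A ⟶ B :=
  Hom.mk (fun a b => b ≤ f a) (fun h h₁ h₂ => h₂.trans (h.trans (f.monotone h₁)))

@[simp] theorem ofMap_comp_rel {A B D : FinScottL.{u}} (f : A →o B) (R : B ⟶ D) (a : A) (d : D) :
    Hom.rel (ofMap f ≫ R) a d ↔ R.rel (f a) d :=
  ⟨fun ⟨_, h, h'⟩ => down R h' h le_rfl, fun h => ⟨f a, le_rfl, h⟩⟩

/-- The isomorphism induced by an isomorphism of preorders. -/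
@[simps]
def ofIso {A B : FinScottL.{u}} (e : A ≃o B) : A ≅ B where
  hom := ofMap e.toOrderEmbedding.toOrderHom
  inv := ofMap e.symm.toOrderEmbedding.toOrderHom
  hom_inv_id := hom_ext fun a b => by rw [ofMap_comp_rel]; simp [ofMap]
  inv_hom_id := hom_ext fun a b => by rw [ofMap_comp_rel]; simp [ofMap]

/-! ### The tensor product -/

/-- `A ⊗ B`, the product of preorders. -/
def tensor (A B : FinScottL.{u}) : FinScottL.{u} := ⟨A × B⟩

/-- `1`, the one-point preorder. -/
def one : FinScottL.{u} := ⟨PUnit⟩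

/-- `R ⊗ S` relates `(a, b)` to `(a', b')` iff `R` relates `a` to `a'` and `S` relates `b`
to `b'`. -/
def tensorMap {A A' B B' : FinScottL.{u}} (R : A ⟶ A') (S : B ⟶ B') :
    tensor A B ⟶ tensor A' B' :=
  Hom.mk (fun (p : A × B) (q : A' × B') => R.rel p.1 q.1 ∧ S.rel p.2 q.2)
    (fun h h₁ h₂ => ⟨down R h.1 h₁.1 h₂.1, down S h.2 h₁.2 h₂.2⟩)

/-- `(A × B) × D ≃ A × (B × D)` as preorders. -/
def assocIso (A B D : FinScottL.{u}) : tensor (tensor A B) D ≃o tensor A (tensor B D) where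
  toEquiv := Equiv.prodAssoc A B D
  map_rel_iff' := ⟨fun h => ⟨⟨h.1, h.2.1⟩, h.2.2⟩, fun h => ⟨h.1.1, h.1.2, h.2⟩⟩

def leftUnitIso (A : FinScottL.{u}) : tensor one A ≃o A where
  toEquiv := Equiv.punitProd A
  map_rel_iff' := ⟨fun h => ⟨le_rfl, h⟩, fun h => h.2⟩

def rightUnitIso (A : FinScottL.{u}) : tensor A one ≃o A where
  toEquiv := Equiv.prodPUnit A
  map_rel_iff' := ⟨fun h => ⟨h, le_rfl⟩, fun h => h.1⟩

instance : MonoidalCategoryStruct FinScottL.{u} where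
  tensorObj := tensor
  tensorUnit := one
  tensorHom := tensorMap
  whiskerLeft A _ _ R := tensorMap (𝟙 A) R
  whiskerRight R B := tensorMap R (𝟙 B)
  associator A B D := ofIso (assocIso A B D)
  leftUnitor A := ofIso (leftUnitIso A)
  rightUnitor A := ofIso (rightUnitIso A)

theorem tensorMap_comp {A A' A'' B B' B'' : FinScottL.{u}} (R : A ⟶ A') (R' : A' ⟶ A'')
    (S : B ⟶ B') (S' : B' ⟶ B'') :
    tensorMap R S ≫ tensorMap R' S' = tensorMap (R ≫ R') (S ≫ S') :=
  hom_ext fun _ _ => ⟨fun ⟨m, h, h'⟩ => ⟨⟨m.1, h.1, h'.1⟩, ⟨m.2, h.2, h'.2⟩⟩,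
    fun ⟨⟨x, h, h'⟩, ⟨y, k, k'⟩⟩ => ⟨(x, y), ⟨h, k⟩, ⟨h', k'⟩⟩⟩

theorem comp_ofIso_rel {A B D : FinScottL.{u}} (R : A ⟶ B) (e : B ≃o D) (a : A) (d : D) :
    Hom.rel (R ≫ (ofIso e).hom) a d ↔ R.rel a (e.symm d) :=
  ⟨fun ⟨_, h, h'⟩ => down R h le_rfl (e.symm_apply_le.2 h'),
    fun h => ⟨_, h, (e.apply_symm_apply d).ge⟩⟩

instance : MonoidalCategory FinScottL.{u} := MonoidalCategory.ofTensorHom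
  (id_tensorHom_id := fun _ _ => rfl)
  (id_tensorHom := fun _ _ _ _ => rfl)
  (tensorHom_id := fun _ _ => rfl)
  (tensorHom_comp_tensorHom := fun _ _ _ _ => tensorMap_comp _ _ _ _)
  (associator_naturality := fun _ _ _ => hom_ext fun a b => by
    rw [show (α_ _ _ _) = ofIso (assocIso _ _ _) from rfl, comp_ofIso_rel,
      show (α_ _ _ _) = ofIso (assocIso _ _ _) from rfl, ofIso_hom, ofMap_comp_rel]
    exact and_assoc)
  (leftUnitor_naturality := fun f => hom_ext fun a b => by
    rw [show (λ_ _) = ofIso (leftUnitIso _) from rfl, comp_ofIso_rel,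
      show (λ_ _) = ofIso (leftUnitIso _) from rfl, ofIso_hom, ofMap_comp_rel]
    exact ⟨fun h => h.2, fun h => ⟨le_rfl, h⟩⟩)
  (rightUnitor_naturality := fun f => hom_ext fun a b => by
    rw [show (ρ_ _) = ofIso (rightUnitIso _) from rfl, comp_ofIso_rel,
      show (ρ_ _) = ofIso (rightUnitIso _) from rfl, ofIso_hom, ofMap_comp_rel]
    exact ⟨fun h => h.1, fun h => ⟨h, le_rfl⟩⟩)
  (pentagon := fun W X Y Z => hom_ext fun a b => by
    constructor
    · rintro ⟨m, ⟨⟨h₁, h₂, h₃⟩, h₄⟩, n, ⟨k₁, ⟨k₂, k₃⟩, k₄⟩, ⟨l₁, l₂, l₃, l₄⟩⟩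
      exact ⟨((a.1.1.1, a.1.1.2), (a.1.2, a.2)), ⟨⟨le_rfl, le_rfl⟩, le_rfl, le_rfl⟩,
        l₁.trans (k₁.trans h₁), l₂.trans (k₂.trans h₂), l₃.trans (k₃.trans h₃),
        l₄.trans (k₄.trans h₄)⟩
    · rintro ⟨m, ⟨⟨h₁, h₂⟩, h₃, h₄⟩, ⟨l₁, l₂, l₃, l₄⟩⟩
      exact ⟨((a.1.1.1, (a.1.1.2, a.1.2)), a.2), ⟨⟨le_rfl, le_rfl, le_rfl⟩, le_rfl⟩,
        (a.1.1.1, ((a.1.1.2, a.1.2), a.2)), ⟨le_rfl, ⟨le_rfl, le_rfl⟩, le_rfl⟩,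
        l₁.trans h₁, l₂.trans h₂, l₃.trans h₃, l₄.trans h₄⟩)
  (triangle := fun X Y => hom_ext fun a b => by
    constructor
    · rintro ⟨m, ⟨h₁, h₂, h₃⟩, l₁, l₂⟩
      exact ⟨l₁.trans h₁, l₂.trans h₃⟩
    · rintro ⟨l₁, l₂⟩
      exact ⟨(a.1.1, (a.1.2, a.2)), ⟨le_rfl, le_rfl, le_rfl⟩, l₁, l₂⟩)

@[simp] theorem whiskerLeft_rel {A B B' : FinScottL.{u}} (R : B ⟶ B') (p : A × B) (q : A × B') :
    Hom.rel (A ◁ R) p q ↔ q.1 ≤ p.1 ∧ R.rel p.2 q.2 := Iff.rfl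

@[simp] theorem whiskerRight_rel {A A' B : FinScottL.{u}} (R : A ⟶ A') (p : A × B)
    (q : A' × B) : Hom.rel (R ▷ B) p q ↔ R.rel p.1 q.1 ∧ q.2 ≤ p.2 := Iff.rfl

/-! ### The cartesian product -/

/-- `A & B`, the disjoint union of preorders. -/
def withObj (A B : FinScottL.{u}) : FinScottL.{u} := ⟨A ⊕ B⟩

/-- `⊤`, the empty preorder. -/
def top : FinScottL.{u} := ⟨PEmpty⟩

def proj₁ (A B : FinScottL.{u}) : withObj A B ⟶ A :=
  Hom.mk (fun (z : A ⊕ B) a => Sum.inl a ≤ z) (fun h h₁ h₂ => (Sum.inl_le_inl_iff.2 h₂).trans (h.trans h₁))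

def proj₂ (A B : FinScottL.{u}) : withObj A B ⟶ B :=
  Hom.mk (fun (z : A ⊕ B) b => Sum.inr b ≤ z) (fun h h₁ h₂ => (Sum.inr_le_inr_iff.2 h₂).trans (h.trans h₁))

def pair {T A B : FinScottL.{u}} (R : T ⟶ A) (S : T ⟶ B) : T ⟶ withObj A B :=
  Hom.mk (fun t (z : A ⊕ B) => Sum.elim (R.rel t) (S.rel t) z) (by
    rintro t t' (a | b) (a' | b') h h₁ h₂
    · exact down R h h₁ (Sum.inl_le_inl_iff.1 h₂)
    · exact (Sum.not_inr_le_inl h₂).elim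
    · exact (Sum.not_inl_le_inr h₂).elim
    · exact down S h h₁ (Sum.inr_le_inr_iff.1 h₂))

theorem comp_proj₁_rel {T A B : FinScottL.{u}} (R : T ⟶ withObj A B) (t : T) (a : A) :
    Hom.rel (R ≫ proj₁ A B) t a ↔ R.rel t (Sum.inl a) :=
  ⟨fun ⟨_, h, h'⟩ => down R h le_rfl h', fun h => ⟨_, h, le_rfl⟩⟩

theorem comp_proj₂_rel {T A B : FinScottL.{u}} (R : T ⟶ withObj A B) (t : T) (b : B) :
    Hom.rel (R ≫ proj₂ A B) t b ↔ R.rel t (Sum.inr b) :=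
  ⟨fun ⟨_, h, h'⟩ => down R h le_rfl h', fun h => ⟨_, h, le_rfl⟩⟩

theorem pair_proj₁ {T A B : FinScottL.{u}} (R : T ⟶ A) (S : T ⟶ B) :
    pair R S ≫ proj₁ A B = R := hom_ext fun t a => comp_proj₁_rel _ t a

theorem pair_proj₂ {T A B : FinScottL.{u}} (R : T ⟶ A) (S : T ⟶ B) :
    pair R S ≫ proj₂ A B = S := hom_ext fun t a => comp_proj₂_rel _ t a

theorem with_ext {T A B : FinScottL.{u}} {R S : T ⟶ withObj A B}
    (h₁ : R ≫ proj₁ A B = S ≫ proj₁ A B) (h₂ : R ≫ proj₂ A B = S ≫ proj₂ A B) : R = S :=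
  hom_ext fun t z => by
    rcases z with a | b
    · exact (comp_proj₁_rel R t a).symm.trans ((by rw [h₁] : _ ↔ _).trans (comp_proj₁_rel S t a))
    · exact (comp_proj₂_rel R t b).symm.trans ((by rw [h₂] : _ ↔ _).trans (comp_proj₂_rel S t b))

/-! ### The exponential comonad -/

/-- The finite subsets of `α`. -/
structure Bang (α : Type u) : Type u where
  elems : Finset α

namespace Bang

instance {α : Type u} : Membership α (Bang α) := ⟨fun s a => a ∈ s.elems⟩

instance {α : Type u} [Finite α] : Finite (Bang α) :=
  Finite.of_injective Bang.elems fun s t h => by cases s; cases t; exact congrArg _ h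

/-- `s ≤ t` iff every element of `s` is below some element of `t`. -/
instance {α : Type u} [Preorder α] : Preorder (Bang α) where
  le s t := ∀ a ∈ s, ∃ b ∈ t, a ≤ b
  le_refl _ a ha := ⟨a, ha, le_rfl⟩
  le_trans _ _ _ h h' a ha :=
    let ⟨b, hb, hab⟩ := h a ha
    let ⟨c, hc, hbc⟩ := h' b hb
    ⟨c, hc, hab.trans hbc⟩

theorem le_def {α : Type u} [Preorder α] {s t : Bang α} : s ≤ t ↔ ∀ a ∈ s, ∃ b ∈ t, a ≤ b :=
  Iff.rfl

/-- A subset of a finite type, as an element of `Bang`. -/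
noncomputable def ofSet {α : Type u} [Finite α] (s : Set α) : Bang α := ⟨s.toFinite.toFinset⟩

@[simp] theorem mem_ofSet {α : Type u} [Finite α] (s : Set α) (a : α) : a ∈ ofSet s ↔ a ∈ s :=
  Set.Finite.mem_toFinset _

instance {α : Type u} : Singleton α (Bang α) := ⟨fun a => ⟨{a}⟩⟩

theorem self_mem {α : Type u} (a : α) : a ∈ ({a} : Bang α) := Finset.mem_singleton_self a

theorem eq_of_mem {α : Type u} {a b : α} (h : a ∈ ({b} : Bang α)) : a = b :=
  Finset.mem_singleton.1 h

/-- The direct image of a finite subset under a relation. -/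
noncomputable def img {α β : Type u} [Finite β] (R : α → β → Prop) (s : Bang α) : Bang β :=
  ofSet {b | ∃ a ∈ s, R a b}

theorem mem_img {α β : Type u} [Finite β] {R : α → β → Prop} {s : Bang α} {b : β} :
    b ∈ img R s ↔ ∃ a ∈ s, R a b := mem_ofSet _ _

end Bang

/-- `!A`. -/
def bangObj (A : FinScottL.{u}) : FinScottL.{u} := ⟨Bang A⟩

/-- `!R = {(s, t) | ∀ b ∈ t, ∃ a ∈ s, (a, b) ∈ R}`. -/
def bangMap {A B : FinScottL.{u}} (R : A ⟶ B) : bangObj A ⟶ bangObj B :=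
  Hom.mk (fun (s : Bang A) (t : Bang B) => ∀ b ∈ t, ∃ a ∈ s, R.rel a b) (by
    intro s s' t t' h h₁ h₂ b hb
    obtain ⟨b', hb', hbb'⟩ := h₂ b hb
    obtain ⟨a, ha, hab⟩ := h b' hb'
    obtain ⟨a', ha', haa'⟩ := h₁ a ha
    exact ⟨a', ha', down R hab haa' hbb'⟩)

theorem bangMap_comp {A B D : FinScottL.{u}} (R : A ⟶ B) (S : B ⟶ D) :
    bangMap (R ≫ S) = bangMap R ≫ bangMap S := hom_ext fun s t => by
  constructor
  · intro h
    refine ⟨Bang.img R.rel s, fun b hb => Bang.mem_img.1 hb, fun d hd => ?_⟩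
    obtain ⟨a, ha, b, hab, hbd⟩ := h d hd
    exact ⟨b, Bang.mem_img.2 ⟨a, ha, hab⟩, hbd⟩
  · rintro ⟨m, h, h'⟩ d hd
    obtain ⟨b, hb, hbd⟩ := h' d hd
    obtain ⟨a, ha, hab⟩ := h b hb
    exact ⟨a, ha, b, hab, hbd⟩

/-- Dereliction `{(s, a') | ∃ a ∈ s, a' ≤ a} : !A ⟶ A`. -/
def bangDer (A : FinScottL.{u}) : bangObj A ⟶ A :=
  Hom.mk (fun (s : Bang A) a' => ∃ a ∈ s, a' ≤ a) (by
    rintro s s' a a' ⟨b, hb, hab⟩ h₁ h₂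
    obtain ⟨b', hb', hbb'⟩ := h₁ b hb
    exact ⟨b', hb', h₂.trans (hab.trans hbb')⟩)

/-- Digging `{(s, S) | ∀ t ∈ S, t ≤ s} : !A ⟶ !!A`. -/
def bangDig (A : FinScottL.{u}) : bangObj A ⟶ bangObj (bangObj A) :=
  Hom.mk (fun (s : Bang A) (S : Bang (Bang A)) => ∀ t ∈ S, t ≤ s) (by
    intro s s' S S' h h₁ h₂ t ht
    obtain ⟨t', ht', htt'⟩ := h₂ t ht
    exact htt'.trans ((h t' ht').trans h₁))

/-- The comonad `!`. -/
def bang : Comonad FinScottL.{u} where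
  obj := bangObj
  map := bangMap
  map_id _ := rfl
  map_comp := bangMap_comp
  ε := { app := bangDer
         naturality := fun A B R => hom_ext fun s b => by
          constructor
          · rintro ⟨t, h, b', hb', hbb'⟩
            obtain ⟨a, ha, hab⟩ := h b' hb'
            exact ⟨a, ⟨a, ha, le_rfl⟩, down R hab le_rfl hbb'⟩
          · rintro ⟨a, ⟨a', ha', haa'⟩, hab⟩
            exact ⟨({b} : Bang B), fun x hx => ⟨a', ha', down R hab haa' (Bang.eq_of_mem hx).le⟩,
              b, Bang.self_mem _, le_rfl⟩ }
  δ := { app := bangDig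
         naturality := fun A B R => hom_ext fun s T => by
          constructor
          · rintro ⟨t, h, h'⟩
            refine ⟨({s} : Bang (Bang A)), fun x hx => (Bang.eq_of_mem hx).le, fun t' ht' => ⟨s, Bang.self_mem _, ?_⟩⟩
            exact down (bangMap R) h le_rfl (h' t' ht')
          · rintro ⟨S, h, h'⟩
            refine ⟨Bang.img R.rel s, fun b hb => Bang.mem_img.1 hb,
              fun t ht b hb => ?_⟩
            obtain ⟨s', hs', hst⟩ := h' t ht
            obtain ⟨a, ha, hab⟩ := hst b hb
            obtain ⟨a', ha', haa'⟩ := h s' hs' a ha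
            exact ⟨b, Bang.mem_img.2 ⟨a', ha', down R hab haa' le_rfl⟩, le_rfl⟩ }
  coassoc A := hom_ext fun s T => by
    constructor
    · rintro ⟨S, h, h'⟩
      refine ⟨({s} : Bang (Bang A)), fun t ht => (Bang.eq_of_mem ht).le, fun t ht x hx => ⟨s, Bang.self_mem _, ?_⟩⟩
      obtain ⟨b, hb, hbt⟩ := h' t ht
      exact (hbt x hx).trans (h b hb)
    · rintro ⟨S, h, h'⟩
      refine ⟨({s} : Bang (Bang A)), fun t ht => (Bang.eq_of_mem ht).le, fun t ht => ⟨s, Bang.self_mem _, ?_⟩⟩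
      intro x hx
      obtain ⟨y, hy, hxy⟩ := h' t ht x hx
      exact hxy.trans (h y hy)
  left_counit A := hom_ext fun s t => by
    constructor
    · rintro ⟨S, h, t', ht', htt'⟩
      exact htt'.trans (h t' ht')
    · intro h
      exact ⟨({t} : Bang (Bang A)), fun x hx => (Bang.eq_of_mem hx).le.trans h, t, Bang.self_mem _, le_rfl⟩
  right_counit A := hom_ext fun s t => by
    constructor
    · rintro ⟨S, h, h'⟩ a ha
      obtain ⟨x, hx, y, hy, hay⟩ := h' a ha
      obtain ⟨b, hb, hyb⟩ := h x hx y hy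
      exact ⟨b, hb, hay.trans hyb⟩
    · intro h
      refine ⟨({s} : Bang (Bang A)), fun x hx => (Bang.eq_of_mem hx).le, fun a ha => ⟨s, Bang.self_mem _, h a ha⟩⟩

/-! ### The colouring comonad -/

/-- The colours: the finitely many natural numbers in `C`, together with a neutral colour `⊥`
which is smaller than all of them. -/
abbrev Col (C : Finset ℕ) : Type := WithBot C

/-- The pairs of a colour and an element of `α`. -/
@[ext]
structure Box (C : Finset ℕ) (α : Type u) : Type u where
  col : Col C
  val : α

instance {C : Finset ℕ} {α : Type u} [Finite α] : Finite (Box C α) :=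
  Finite.of_injective (fun x : Box C α => ((x.col, x.val) : Col C × α)) fun _ _ h =>
    Box.ext (congrArg Prod.fst h) (congrArg Prod.snd h)

/-- Elements of different colours are incomparable. -/
instance {C : Finset ℕ} {α : Type u} [Preorder α] : Preorder (Box C α) where
  le x y := x.col = y.col ∧ x.val ≤ y.val
  le_refl _ := ⟨rfl, le_rfl⟩
  le_trans _ _ _ h h' := ⟨h.1.trans h'.1, h.2.trans h'.2⟩

section

variable (C : Finset ℕ)

/-- `□A`. -/
def boxObj (A : FinScottL.{u}) : FinScottL.{u} := ⟨Box C A⟩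

/-- `□R` relates `(i, a)` to `(j, b)` iff `i = j` and `R` relates `a` to `b`. -/
def boxMap {A B : FinScottL.{u}} (R : A ⟶ B) : boxObj C A ⟶ boxObj C B :=
  Hom.mk (fun (x : Box C A) (y : Box C B) => x.col = y.col ∧ R.rel x.val y.val)
    (fun h h₁ h₂ => ⟨h₁.1.symm.trans (h.1.trans h₂.1.symm), down R h.2 h₁.2 h₂.2⟩)

/-- `{((ε, a), a') | a' ≤ a} : □A ⟶ A`. -/
def boxDer (A : FinScottL.{u}) : boxObj C A ⟶ A :=
  Hom.mk (fun (x : Box C A) a' => x.col = ⊥ ∧ a' ≤ x.val)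
    (fun h h₁ h₂ => ⟨h₁.1.symm.trans h.1, h₂.trans (h.2.trans h₁.2)⟩)

/-- `{((max c₁ c₂, a), (c₁, (c₂, a'))) | a' ≤ a} : □A ⟶ □□A`. -/
def boxDig (A : FinScottL.{u}) : boxObj C A ⟶ boxObj C (boxObj C A) :=
  Hom.mk (fun (x : Box C A) (y : Box C (Box C A)) =>
      x.col = max y.col y.val.col ∧ y.val.val ≤ x.val)
    (fun h h₁ h₂ => ⟨by rw [← h₁.1, h.1, h₂.1, h₂.2.1], h₂.2.2.trans (h.2.trans h₁.2)⟩)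

/-- The comonad `□`. -/
def box : Comonad FinScottL.{u} where
  obj := boxObj C
  map := boxMap C
  map_id _ := hom_ext fun _ _ => and_congr_left' eq_comm
  map_comp R S := hom_ext fun x z =>
    ⟨fun ⟨h, b, h₁, h₂⟩ => ⟨⟨x.col, b⟩, ⟨rfl, h₁⟩, h, h₂⟩,
      fun ⟨y, ⟨h, h₁⟩, h', h₂⟩ => ⟨h.trans h', y.val, h₁, h₂⟩⟩
  ε := { app := boxDer C
         naturality := fun A B R => hom_ext fun x b =>
          ⟨fun ⟨y, ⟨h, h₁⟩, h', h₂⟩ => ⟨x.val, ⟨h.trans h', le_rfl⟩, down R h₁ le_rfl h₂⟩,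
            fun ⟨a, ⟨h, h'⟩, h₁⟩ => ⟨⟨x.col, b⟩, ⟨rfl, down R h₁ h' le_rfl⟩, h, le_rfl⟩⟩ }
  δ := { app := boxDig C
         naturality := fun A B R => hom_ext fun x z =>
          ⟨fun ⟨y, ⟨h, h₁⟩, h', h₂⟩ => ⟨⟨z.col, ⟨z.val.col, x.val⟩⟩, ⟨h.trans h', le_rfl⟩,
              rfl, rfl, down R h₁ le_rfl h₂⟩,
            fun ⟨y, ⟨h, h₁⟩, h', h'', h₂⟩ => ⟨⟨x.col, z.val.val⟩, ⟨rfl, down R h₂ h₁ le_rfl⟩,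
              by rw [h, h', h''], le_rfl⟩⟩ }
  coassoc A := hom_ext fun x w =>
    ⟨fun ⟨y, ⟨h, h₁⟩, h', h₂⟩ =>
        ⟨⟨max w.col w.val.col, ⟨w.val.val.col, x.val⟩⟩,
          ⟨h.trans ((congrArg₂ max h' h₂.1).trans (max_assoc _ _ _).symm), le_rfl⟩,
          rfl, rfl, h₂.2.trans h₁⟩,
      fun ⟨y, ⟨h, h₁⟩, h', h₂⟩ =>
        ⟨⟨w.col, ⟨max w.val.col w.val.val.col, x.val⟩⟩,
          ⟨h.trans ((congrArg₂ max h' h₂.1.symm).trans (max_assoc _ _ _)), le_rfl⟩,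
          rfl, rfl, h₂.2.trans h₁⟩⟩
  left_counit A := hom_ext fun x z =>
    ⟨fun ⟨y, ⟨h, h₁⟩, h', h₂⟩ => ⟨by rw [h, h', h₂.1, bot_sup_eq], h₂.2.trans h₁⟩,
      fun ⟨h, h₁⟩ => ⟨⟨⊥, z⟩, ⟨by rw [← h, bot_sup_eq], h₁⟩, rfl, le_rfl⟩⟩
  right_counit A := hom_ext fun x z =>
    ⟨fun ⟨y, ⟨h, h₁⟩, h', h₂⟩ => ⟨by rw [h, h', h₂.1, sup_bot_eq], h₂.2.trans h₁⟩,
      fun ⟨h, h₁⟩ => ⟨⟨z.col, ⟨⊥, z.val⟩⟩, ⟨by rw [← h, sup_bot_eq], h₁⟩, rfl, rfl, le_rfl⟩⟩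

/-- The distributive law `λ : !□A ⟶ □!A`, which relates `s` to `(c, t)` iff every `a ∈ t`
is below some `a'` with `(c, a') ∈ s`. -/
def distrib (A : FinScottL.{u}) : bangObj (boxObj C A) ⟶ boxObj C (bangObj A) :=
  Hom.mk (fun (s : Bang (Box C A)) (y : Box C (Bang A)) =>
      ∀ a ∈ y.val, ∃ x ∈ s, y.col = x.col ∧ a ≤ x.val) (by
    intro s s' y y' h h₁ h₂ a ha
    obtain ⟨b, hb, hab⟩ := h₂.2 a ha
    obtain ⟨x, hx, hc, hbx⟩ := h b hb
    obtain ⟨x', hx', hc', hxx'⟩ := h₁ x hx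
    exact ⟨x', hx', h₂.1.trans (hc.trans hc'), hab.trans (hbx.trans hxx')⟩)

/-! ### The coloured exponential -/

/-- The coloured exponential `!□A`. -/
def colObj (A : FinScottL.{u}) : FinScottL.{u} := bangObj (boxObj C A)

def colMap {A B : FinScottL.{u}} (R : A ⟶ B) : colObj C A ⟶ colObj C B := bangMap (boxMap C R)

/-- The counit of `!□`. -/
def colDer (A : FinScottL.{u}) : colObj C A ⟶ A := bangMap (boxDer C A) ≫ bangDer A

/-- The comultiplication `!□A ⟶ !□□A ⟶ !!□□A ⟶ !□!□A` of `!□`, obtained from the comultiplications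
of `□` and `!` and from the distributive law. -/
def colDig (A : FinScottL.{u}) : colObj C A ⟶ colObj C (colObj C A) :=
  bangMap (boxDig C A) ≫ bangDig (boxObj C (boxObj C A)) ≫ bangMap (distrib C (boxObj C A))

variable {C}

/-- `□_c s ≤ u`: painting `s` with the colour `c` gives something below `u`. -/
def Bang.Paint {α : Type u} [Preorder α] (c : Col C) (s u : Bang (Box C α)) : Prop :=
  ∀ z ∈ s, ∃ x ∈ u, x.col = max c z.col ∧ z.val ≤ x.val

/-- The largest `s` with `□_c s ≤ u`. -/
noncomputable def Bang.unpaint {α : Type u} [Preorder α] [Finite α] (c : Col C)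
    (u : Bang (Box C α)) : Bang (Box C α) :=
  Bang.ofSet {z | ∃ x ∈ u, x.col = max c z.col ∧ z.val ≤ x.val}

theorem Bang.unpaint_paint {α : Type u} [Preorder α] [Finite α] (c : Col C)
    (u : Bang (Box C α)) : Bang.Paint c (Bang.unpaint c u) u :=
  fun z hz => (Bang.mem_ofSet _ z).1 hz

theorem Bang.Paint.mem {α : Type u} [Preorder α] [Finite α] {c : Col C}
    {s u : Bang (Box C α)} (h : Bang.Paint c s u) {z : Box C α} (hz : z ∈ s) :
    z ∈ Bang.unpaint c u := (Bang.mem_ofSet _ _).2 (h z hz)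

theorem Bang.Paint.mono {α : Type u} [Preorder α] {c : Col C}
    {s s' u u' : Bang (Box C α)} (h : Bang.Paint c s u) (hs : s' ≤ s) (hu : u ≤ u') :
    Bang.Paint c s' u' := fun z hz => by
  obtain ⟨y, hy, hzy, hzy'⟩ := hs z hz
  obtain ⟨x, hx, hxy, hxy'⟩ := h y hy
  obtain ⟨w, hw, hxw, hxw'⟩ := hu x hx
  exact ⟨w, hw, by rw [← hxw, hxy, hzy], hzy'.trans (hxy'.trans hxw')⟩

theorem Bang.Paint.trans {α : Type u} [Preorder α] {c d : Col C}
    {s t u : Bang (Box C α)} (h : Bang.Paint c s t) (h' : Bang.Paint d t u) :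
    Bang.Paint (max d c) s u := fun z hz => by
  obtain ⟨y, hy, hzy, hzy'⟩ := h z hz
  obtain ⟨x, hx, hxy, hxy'⟩ := h' y hy
  exact ⟨x, hx, by rw [hxy, hzy, max_assoc], hzy'.trans hxy'⟩

theorem Bang.paint_bot {α : Type u} [Preorder α] {s u : Bang (Box C α)} :
    Bang.Paint ⊥ s u ↔ s ≤ u := by
  constructor
  · intro h z hz
    obtain ⟨x, hx, h₁, h₂⟩ := h z hz
    exact ⟨x, hx, by rw [h₁, bot_sup_eq], h₂⟩
  · intro h z hz
    obtain ⟨x, hx, h₁, h₂⟩ := h z hz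
    exact ⟨x, hx, by rw [bot_sup_eq, h₁], h₂⟩

theorem colMap_rel {A B : FinScottL.{u}} (R : A ⟶ B) (s : Bang (Box C A)) (t : Bang (Box C B)) :
    (colMap C R).rel s t ↔ ∀ y ∈ t, ∃ x ∈ s, x.col = y.col ∧ R.rel x.val y.val := Iff.rfl

theorem colDer_rel {A : FinScottL.{u}} (s : Bang (Box C A)) (a : A) :
    (colDer C A).rel s a ↔ ∃ x ∈ s, x.col = ⊥ ∧ a ≤ x.val := by
  constructor
  · rintro ⟨t, h, b, hb, hab⟩
    obtain ⟨x, hx, hc, hbx⟩ := h b hb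
    exact ⟨x, hx, hc, hab.trans hbx⟩
  · rintro ⟨x, hx, hc, hax⟩
    exact ⟨({a} : Bang A), fun b hb => ⟨x, hx, hc, (Bang.eq_of_mem hb).le.trans hax⟩, a,
      Bang.self_mem _, le_rfl⟩

theorem colDig_rel {A : FinScottL.{u}} (u : Bang (Box C A)) (U : Bang (Box C (Bang (Box C A)))) :
    (colDig C A).rel u U ↔ ∀ y ∈ U, Bang.Paint y.col y.val u := by
  constructor
  · rintro ⟨V, h, W, h', h''⟩ y hy z hz
    obtain ⟨t, ht, k⟩ := h'' y hy
    obtain ⟨x, hx, hxy, hzx⟩ := k z hz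
    obtain ⟨x', hx', hxx', hxx''⟩ := h' t ht x hx
    obtain ⟨p, hp, hpx, hpx'⟩ := h x' hx'
    exact ⟨p, hp, by rw [hpx, ← hxx', hxy, hzx.1, hxx''.1], hzx.2.trans (hxx''.2.trans hpx')⟩
  · intro h
    let V : Bang (Box C (Box C A)) := Bang.img (boxDig C A).rel u
    refine ⟨V, fun b hb => Bang.mem_img.1 hb, ({V} : Bang (Bang (Box C (Box C A)))),
      fun t ht => (Bang.eq_of_mem ht).le, fun y hy => ⟨V, Bang.self_mem _, fun z hz => ?_⟩⟩
    obtain ⟨x, hx, hc, hzx⟩ := h y hy z hz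
    exact ⟨(⟨y.col, z⟩ : Box C (Box C A)), Bang.mem_img.2 ⟨x, hx, hc, hzx⟩, rfl, le_rfl⟩

/-- The promotion `!□A ⟶ !□B` of `R : !□A ⟶ B`. -/
def prom {A B : FinScottL.{u}} (R : colObj C A ⟶ B) : colObj C A ⟶ colObj C B :=
  colDig C A ≫ colMap C R

theorem prom_rel {A B : FinScottL.{u}} (R : colObj C A ⟶ B) (u : Bang (Box C A))
    (t : Bang (Box C B)) :
    (prom R).rel u t ↔ ∀ y ∈ t, R.rel (Bang.unpaint y.col u) y.val := by
  constructor
  · rintro ⟨U, h, h'⟩ y hy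
    obtain ⟨x, hx, hxy, hR⟩ := h' y hy
    exact down R hR (fun z hz => ⟨z, hxy ▸ ((colDig_rel u U).1 h x hx).mem hz, le_rfl⟩) le_rfl
  · intro h
    refine ⟨(Bang.ofSet {y | Bang.Paint y.col y.val u} : Bang (Box C (Bang (Box C A)))),
      (colDig_rel _ _).2 fun y hy => (Bang.mem_ofSet _ _).1 hy, fun y hy => ?_⟩
    exact ⟨(⟨y.col, Bang.unpaint y.col u⟩ : Box C (Bang (Box C A))),
      (Bang.mem_ofSet _ _).2 (Bang.unpaint_paint _ _), rfl, h y hy⟩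

end

/-- The comonad `!□`. -/
def colBang (C : Finset ℕ) : Comonad FinScottL.{u} where
  obj := colObj C
  map := colMap C
  map_id A := ((congrArg bangMap ((box C).map_id A)).trans (bang.map_id _) : _)
  map_comp R S := ((congrArg bangMap ((box C).map_comp R S)).trans (bangMap_comp _ _) : _)
  ε := { app := colDer C
         naturality := fun A B R => hom_ext fun s b => by
          rw [comp_rel, comp_rel]
          constructor
          · rintro ⟨t, h, h'⟩
            obtain ⟨y, hy, hc, hby⟩ := (colDer_rel _ _).1 h'
            obtain ⟨x, hx, hxy, hR⟩ := h y hy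
            exact ⟨x.val, (colDer_rel _ _).2 ⟨x, hx, hxy.trans hc, le_rfl⟩, down R hR le_rfl hby⟩
          · rintro ⟨a, h, hR⟩
            obtain ⟨x, hx, hc, hax⟩ := (colDer_rel _ _).1 h
            exact ⟨({⟨⊥, b⟩} : Bang (Box C B)), fun y hy => ⟨x, hx, by
              obtain rfl := Bang.eq_of_mem hy; exact ⟨hc, down R hR hax le_rfl⟩⟩,
              (colDer_rel _ _).2 ⟨⟨⊥, b⟩, Bang.self_mem _, rfl, le_rfl⟩⟩ }
  δ := { app := colDig C
         naturality := fun A B R => hom_ext fun s T => by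
          refine Iff.trans ?_ (prom_rel (colMap C R) s T).symm
          constructor
          · rintro ⟨t, h, h'⟩ y hy z hz
            obtain ⟨x, hx, hxy, hzx⟩ := (colDig_rel _ _).1 h' y hy z hz
            obtain ⟨p, hp, hpx, hR⟩ := h x hx
            exact ⟨⟨z.col, p.val⟩, (Bang.mem_ofSet _ _).2 ⟨p, hp, hpx.trans hxy, le_rfl⟩,
              rfl, down R hR le_rfl hzx⟩
          · intro h
            refine ⟨Bang.img (boxMap C R).rel s, fun y hy => Bang.mem_img.1 hy,
              (colDig_rel _ _).2 fun y hy z hz => ?_⟩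
            obtain ⟨x, hx, hxz, hR⟩ := h y hy z hz
            obtain ⟨p, hp, hpx, hxp⟩ := (Bang.mem_ofSet _ _).1 hx
            exact ⟨⟨max y.col z.col, z.val⟩, Bang.mem_img.2 ⟨p, hp, by rw [hpx, hxz],
              down R hR hxp le_rfl⟩, rfl, le_rfl⟩ }
  coassoc A := hom_ext fun s T => by
    refine (prom_rel (colDig C A) s T).trans ?_
    constructor
    · intro h
      refine ⟨(Bang.ofSet {y | Bang.Paint y.col y.val s} : Bang (Box C (Bang (Box C A)))),
        (colDig_rel _ _).2 fun y hy => (Bang.mem_ofSet _ _).1 hy,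
        (colDig_rel _ _).2 fun y hy z hz => ?_⟩
      have := (colDig_rel _ _).1 (h y hy) z hz
      exact ⟨(⟨max y.col z.col, z.val⟩ : Box C (Bang (Box C A))),
        (Bang.mem_ofSet _ _).2 (this.trans (Bang.unpaint_paint _ _)), rfl, le_rfl⟩
    · rintro ⟨U, h, h'⟩ y hy
      refine (colDig_rel _ _).2 fun z hz p hp => ?_
      obtain ⟨x, hx, hxy, hzx⟩ := (colDig_rel _ _).1 h' y hy z hz
      obtain ⟨q, hq, hpq, hpq'⟩ := hzx p hp
      obtain ⟨r, hr, hrq, hrq'⟩ := (colDig_rel _ _).1 h x hx q hq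
      exact ⟨⟨max z.col p.col, p.val⟩, (Bang.mem_ofSet _ _).2 ⟨r, hr, by
        rw [hrq, hxy, ← hpq, max_assoc], hpq'.trans hrq'⟩, rfl, le_rfl⟩
  left_counit A := hom_ext fun s t => by
    constructor
    · rintro ⟨U, h, h'⟩
      obtain ⟨y, hy, hc, hty⟩ := (colDer_rel _ _).1 h'
      have := (colDig_rel _ _).1 h y hy
      rw [hc] at this
      exact hty.trans (Bang.paint_bot.1 this)
    · intro h
      refine ⟨({⟨⊥, t⟩} : Bang (Box C (Bang (Box C A)))), (colDig_rel _ _).2 fun y hy => ?_,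
        (colDer_rel _ _).2 ⟨_, Bang.self_mem _, rfl, le_rfl⟩⟩
      obtain rfl := Bang.eq_of_mem hy
      exact Bang.paint_bot.2 h
  right_counit A := hom_ext fun s t => by
    refine (prom_rel (colDer C A) s t).trans (forall₂_congr fun y hy => ?_)
    rw [colDer_rel]
    constructor
    · rintro ⟨x, hx, hc, hyx⟩
      obtain ⟨p, hp, hpx, hxp⟩ := (Bang.mem_ofSet _ _).1 hx
      exact ⟨p, hp, by rw [hpx, hc, sup_bot_eq], hyx.trans hxp⟩
    · rintro ⟨x, hx, hc, hyx⟩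
      exact ⟨⟨⊥, y.val⟩, (Bang.mem_ofSet _ _).2 ⟨x, hx, by rw [sup_bot_eq]; exact hc.symm, hyx⟩,
        rfl, le_rfl⟩

/-! ### The Seely isomorphisms and contraction -/

section

variable {C : Finset ℕ}

/-- The disjoint union of a finite subset of `Col × α` and a finite subset of `Col × β`. -/
noncomputable def Bang.merge {α β : Type u} [Finite α] [Finite β] (s : Bang (Box C α))
    (t : Bang (Box C β)) : Bang (Box C (α ⊕ β)) :=
  Bang.ofSet {y | Sum.elim (fun a => (⟨y.col, a⟩ : Box C α) ∈ s)
    (fun b => (⟨y.col, b⟩ : Box C β) ∈ t) y.val}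

/-- The part in `α` of a finite subset of `Col × (α ⊎ β)`. -/
noncomputable def Bang.left {α β : Type u} [Finite α] (s : Bang (Box C (α ⊕ β))) : Bang (Box C α) :=
  Bang.ofSet {x | (⟨x.col, Sum.inl x.val⟩ : Box C (α ⊕ β)) ∈ s}

/-- The part in `β` of a finite subset of `Col × (α ⊎ β)`. -/
noncomputable def Bang.right {α β : Type u} [Finite β] (s : Bang (Box C (α ⊕ β))) :
    Bang (Box C β) :=
  Bang.ofSet {x | (⟨x.col, Sum.inr x.val⟩ : Box C (α ⊕ β)) ∈ s}

theorem Bang.ext {α : Type u} {s t : Bang α} (h : ∀ a, a ∈ s ↔ a ∈ t) : s = t := by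
  cases s; cases t
  exact congrArg _ (Finset.ext h)

theorem Bang.inl_mem_merge {α β : Type u} [Finite α] [Finite β] {s : Bang (Box C α)}
    {t : Bang (Box C β)} {c : Col C} {a : α} :
    (⟨c, Sum.inl a⟩ : Box C (α ⊕ β)) ∈ Bang.merge s t ↔ (⟨c, a⟩ : Box C α) ∈ s :=
  Bang.mem_ofSet _ _

theorem Bang.inr_mem_merge {α β : Type u} [Finite α] [Finite β] {s : Bang (Box C α)}
    {t : Bang (Box C β)} {c : Col C} {b : β} :
    (⟨c, Sum.inr b⟩ : Box C (α ⊕ β)) ∈ Bang.merge s t ↔ (⟨c, b⟩ : Box C β) ∈ t :=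
  Bang.mem_ofSet _ _

theorem Bang.mem_left {α β : Type u} [Finite α] {s : Bang (Box C (α ⊕ β))} {c : Col C} {a : α} :
    (⟨c, a⟩ : Box C α) ∈ s.left ↔ (⟨c, Sum.inl a⟩ : Box C (α ⊕ β)) ∈ s := Bang.mem_ofSet _ _

theorem Bang.mem_right {α β : Type u} [Finite β] {s : Bang (Box C (α ⊕ β))} {c : Col C} {b : β} :
    (⟨c, b⟩ : Box C β) ∈ s.right ↔ (⟨c, Sum.inr b⟩ : Box C (α ⊕ β)) ∈ s := Bang.mem_ofSet _ _

/-- Disjoint union is an isomorphism of preorders. -/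
noncomputable def mergeIso (α β : Type u) [Preorder α] [Preorder β] [Finite α] [Finite β] :
    Bang (Box C α) × Bang (Box C β) ≃o Bang (Box C (α ⊕ β)) where
  toFun p := Bang.merge p.1 p.2
  invFun s := (s.left, s.right)
  left_inv p := Prod.ext (Bang.ext fun ⟨_, _⟩ => Bang.mem_left.trans Bang.inl_mem_merge)
    (Bang.ext fun ⟨_, _⟩ => Bang.mem_right.trans Bang.inr_mem_merge)
  right_inv s := Bang.ext fun y => by
    rcases y with ⟨c, a | b⟩
    · exact Bang.inl_mem_merge.trans Bang.mem_left
    · exact Bang.inr_mem_merge.trans Bang.mem_right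
  map_rel_iff' := by
    rintro ⟨s, t⟩ ⟨s', t'⟩
    constructor
    · intro h
      constructor
      · rintro ⟨c, a⟩ hx
        obtain ⟨⟨d, a' | b'⟩, hy, hc, hxy⟩ := h ⟨c, Sum.inl a⟩ (Bang.inl_mem_merge.2 hx)
        · exact ⟨⟨d, a'⟩, Bang.inl_mem_merge.1 hy, hc, Sum.inl_le_inl_iff.1 hxy⟩
        · exact (Sum.not_inl_le_inr hxy).elim
      · rintro ⟨c, b⟩ hx
        obtain ⟨⟨d, a' | b'⟩, hy, hc, hxy⟩ := h ⟨c, Sum.inr b⟩ (Bang.inr_mem_merge.2 hx)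
        · exact (Sum.not_inr_le_inl hxy).elim
        · exact ⟨⟨d, b'⟩, Bang.inr_mem_merge.1 hy, hc, Sum.inr_le_inr_iff.1 hxy⟩
    · rintro ⟨h, h'⟩ ⟨c, a | b⟩ hy
      · obtain ⟨⟨d, a'⟩, hx, hc, hax⟩ := h _ (Bang.inl_mem_merge.1 hy)
        exact ⟨⟨d, Sum.inl a'⟩, Bang.inl_mem_merge.2 hx, hc, Sum.inl_le_inl_iff.2 hax⟩
      · obtain ⟨⟨d, b'⟩, hx, hc, hbx⟩ := h' _ (Bang.inr_mem_merge.1 hy)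
        exact ⟨⟨d, Sum.inr b'⟩, Bang.inr_mem_merge.2 hx, hc, Sum.inr_le_inr_iff.2 hbx⟩

/-- The Seely isomorphism `!□A ⊗ !□B ≅ !□(A & B)`. -/
noncomputable def seely (A B : FinScottL.{u}) :
    colObj C A ⊗ colObj C B ≅ colObj C (withObj A B) :=
  ofIso (A := tensor (colObj C A) (colObj C B)) (B := colObj C (withObj A B)) (mergeIso A B)

/-- Contraction `!□A ⟶ !□(A & A) ≅ !□A ⊗ !□A`. -/
noncomputable def con (A : FinScottL.{u}) : colObj C A ⟶ colObj C A ⊗ colObj C A :=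
  colMap C (pair (𝟙 A) (𝟙 A)) ≫ (seely A A).inv

/-- The promotion `!□X ⊗ !□A ≅ !□(X & A) ⟶ !□B` of `g : !□X ⊗ !□A ⟶ B`. -/
noncomputable def prom₂ {X A B : FinScottL.{u}} (g : colObj C X ⊗ colObj C A ⟶ B) :
    colObj C X ⊗ colObj C A ⟶ colObj C B :=
  (seely X A).hom ≫ prom ((seely X A).inv ≫ g)

/-- The parametrised composite `f ⋆ g : !□X ⊗ !□A ⟶ A` of `f : !□X ⊗ !□B ⟶ A` and
`g : !□X ⊗ !□A ⟶ B`. -/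
noncomputable def star {X A B : FinScottL.{u}} (f : colObj C X ⊗ colObj C B ⟶ A)
    (g : colObj C X ⊗ colObj C A ⟶ B) : colObj C X ⊗ colObj C A ⟶ A :=
  con X ▷ colObj C A ≫ (α_ (colObj C X) (colObj C X) (colObj C A)).hom ≫
    colObj C X ◁ prom₂ g ≫ f

end

/-- Conway operators over `FinScottL`, for the exponential `!□`. -/
structure IsConwayOperator (C : Finset ℕ)
    (Y : ∀ X A : FinScottL.{u}, (colObj C X ⊗ colObj C A ⟶ A) → (colObj C X ⟶ A)) : Prop where
  /-- naturality in the parameter -/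
  natural : ∀ {X Z A : FinScottL.{u}} (g : colObj C X ⟶ Z) (f : colObj C Z ⊗ colObj C A ⟶ A),
    Y X A (prom g ▷ colObj C A ≫ f) = prom g ≫ Y Z A f
  /-- the parametrised fixpoint property -/
  fixpoint : ∀ {X A : FinScottL.{u}} (f : colObj C X ⊗ colObj C A ⟶ A),
    Y X A f = con X ≫ colObj C X ◁ prom (Y X A f) ≫ f
  /-- parametrised dinaturality -/
  dinatural : ∀ {X A B : FinScottL.{u}} (f : colObj C X ⊗ colObj C B ⟶ A)
    (g : colObj C X ⊗ colObj C A ⟶ B),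
    Y X A (star f g) = con X ≫ colObj C X ◁ prom (Y X B (star g f)) ≫ f
  /-- the diagonal property -/
  diagonal : ∀ {X A : FinScottL.{u}} (f : (colObj C X ⊗ colObj C A) ⊗ colObj C A ⟶ A),
    Y X A ((seely X A).hom ≫ Y (withObj X A) A ((seely X A).inv ▷ colObj C A ≫ f)) =
      Y X A (colObj C X ◁ con A ≫ (α_ (colObj C X) (colObj C A) (colObj C A)).inv ≫ f)

/-! ### Semantic run-trees and the fixpoint operator -/

/-- A finitely branching, possibly infinite tree whose nodes carry a label in `L` and a colour.
Nodes are addressed by the lists of child indices read from the node up to the root: `[]` is the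
root and `i :: p` is the child number `i` of `p`, for `i < arity p`. Only the values of `arity`,
`label` and `col` at nodes matter. -/
structure ColTree (C : Finset ℕ) (L : Type u) where
  arity : List ℕ → ℕ
  label : List ℕ → L
  col : List ℕ → Col C

namespace ColTree

variable {C : Finset ℕ} {L : Type u} (t : ColTree C L)

/-- The addresses of the nodes of the tree. -/
def IsNode : List ℕ → Prop
  | [] => True
  | i :: p => IsNode p ∧ i < t.arity p

/-- The maximal colour on the path from a node to the root, both included. -/
def pathCol : List ℕ → Col C
  | [] => t.col []
  | i :: p => max (t.col (i :: p)) (pathCol p)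

/-- The node at depth `n` of the branch which takes the child number `s k` at depth `k`. -/
def pos (s : ℕ → ℕ) : ℕ → List ℕ
  | 0 => []
  | n + 1 => s n :: pos s n

/-- Every infinite branch has a non-neutral colour occurring infinitely often, and the greatest
such colour is even. -/
def Winning : Prop :=
  ∀ s : ℕ → ℕ, (∀ n, t.IsNode (pos s n)) →
    ∃ c : C, (∃ᶠ n in Filter.atTop, t.col (pos s n) = (c : Col C)) ∧
      (∀ d : C, (∃ᶠ n in Filter.atTop, t.col (pos s n) = (d : Col C)) → d ≤ c) ∧ Even (c : ℕ)

variable {X A : FinScottL.{u}} (t : ColTree C (X ⊕ A))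

/-- The set of pairs of the colour and the label of the children of `p` with a label in `X`. -/
noncomputable def childrenX (p : List ℕ) : Bang (Box C X) :=
  Bang.ofSet {y | ∃ i < t.arity p, t.col (i :: p) = y.col ∧ t.label (i :: p) = Sum.inl y.val}

/-- The set of pairs of the colour and the label of the children of `p` with a label in `A`. -/
noncomputable def childrenA (p : List ℕ) : Bang (Box C A) :=
  Bang.ofSet {y | ∃ i < t.arity p, t.col (i :: p) = y.col ∧ t.label (i :: p) = Sum.inr y.val}

/-- `t` is a semantic run-tree of `R` producing `a`. When the node in `step` is a leaf, both sets
of children are empty. -/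
structure IsRunTree (R : colObj C X ⊗ colObj C A ⟶ A) (a : A) : Prop where
  root_label : t.label [] = Sum.inr a
  root_col : t.col [] = ⊥
  inner : ∀ p, t.IsNode p → 0 < t.arity p → ∃ b, t.label p = Sum.inr b
  step : ∀ p b, t.IsNode p → t.label p = Sum.inr b → R.rel (t.childrenX p, t.childrenA p) b

/-- The set of pairs `(c, x)` for `x` the label in `X` of a leaf and `c` the maximal colour on
the path from this leaf to the root. -/
def leaves : Set (Box C X) :=
  {y | ∃ p, t.IsNode p ∧ t.label p = Sum.inl y.val ∧ t.pathCol p = y.col}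

end ColTree
/-- `(u, a)` is in `Y(R)` iff `u` is the set of leaves of some winning semantic run-tree of `R`
producing `a`. -/
def fixRel {C : Finset ℕ} {X A : FinScottL.{u}} (R : colObj C X ⊗ colObj C A ⟶ A)
    (s : Bang (Box C X)) (a : A) : Prop :=
  ∃ t : ColTree C (X ⊕ A), t.IsRunTree R a ∧ t.Winning ∧ t.leaves = {y | y ∈ s}

namespace ColTree

variable {C : Finset ℕ} {X A : FinScottL.{u}} (t : ColTree C (X ⊕ A)) (a : A) (f : Box C X → X)
  (l : List (Box C X))

/-- The leaves added in `modify`. -/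
def extra : List ℕ → Option (Box C X)
  | [i] => if t.arity [] ≤ i then l[i - t.arity []]? else none
  | _ => none

/-- Relabel the root of `t` with `a`, relabel its leaves in `X` by means of `f`, and add the
elements of the list `l` as leaves below the root. -/
def modify : ColTree C (X ⊕ A) where
  arity p := if p = [] then t.arity [] + l.length else
    (t.extra l p).elim (t.arity p) fun _ => 0
  label p := if p = [] then Sum.inr a else
    (t.extra l p).elim ((t.label p).map (fun x => f ⟨t.pathCol p, x⟩) id) fun y => Sum.inl y.val
  col p := (t.extra l p).elim (t.col p) Box.col

theorem extra_eq_some {p : List ℕ} {y : Box C X} :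
    t.extra l p = some y ↔ ∃ j, p = [t.arity [] + j] ∧ l[j]? = some y := by
  constructor
  · intro h
    match p with
    | [] => simp [extra] at h
    | [i] =>
      by_cases hi : t.arity [] ≤ i
      · exact ⟨i - t.arity [], by simp [hi], by simpa [extra, hi] using h⟩
      · simp [extra, hi] at h
    | i :: j :: q => simp [extra] at h
  · rintro ⟨j, rfl, h⟩
    simpa [extra] using h

theorem extra_of_isNode {p : List ℕ} (hp : t.IsNode p) : t.extra l p = none := by
  rw [Option.eq_none_iff_forall_ne_some]
  intro y h
  obtain ⟨j, rfl, -⟩ := (t.extra_eq_some l).1 h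
  have := hp.2
  omega

theorem modify_arity {p : List ℕ} (hp : t.IsNode p) (h : p ≠ []) :
    (t.modify a f l).arity p = t.arity p := by
  simp [modify, h, t.extra_of_isNode l hp]

theorem modify_label {p : List ℕ} (hp : t.IsNode p) (h : p ≠ []) :
    (t.modify a f l).label p = (t.label p).map (fun x => f ⟨t.pathCol p, x⟩) id := by
  simp [modify, h, t.extra_of_isNode l hp]

theorem modify_col {p : List ℕ} (hp : t.IsNode p) : (t.modify a f l).col p = t.col p := by
  simp [modify, t.extra_of_isNode l hp]

theorem modify_isNode {p : List ℕ} :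
    (t.modify a f l).IsNode p ↔ t.IsNode p ∨ ∃ y, t.extra l p = some y := by
  induction p with
  | nil => simp [IsNode]
  | cons i p ih =>
    rw [IsNode, ih]
    constructor
    · rintro ⟨h | ⟨y, hy⟩, hi⟩
      · by_cases hp : p = []
        · subst hp
          by_cases hi' : i < t.arity []
          · exact Or.inl ⟨h, hi'⟩
          · simp only [modify, if_true] at hi
            exact Or.inr ⟨l[i - t.arity []], (t.extra_eq_some l).2 ⟨i - t.arity [], by
              rw [Nat.add_sub_cancel' (by omega)], by simp⟩⟩
        · rw [modify_arity t a f l h hp] at hi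
          exact Or.inl ⟨h, hi⟩
      · exfalso
        have hp : p ≠ [] := by rintro rfl; simp [extra] at hy
        simp [modify, hp, hy] at hi
    · rintro (⟨h, hi⟩ | ⟨y, hy⟩)
      · refine ⟨Or.inl h, ?_⟩
        by_cases hp : p = []
        · subst hp
          simp only [modify, if_true]
          omega
        · rwa [modify_arity t a f l h hp]
      · obtain ⟨j, hj, hy'⟩ := (t.extra_eq_some l).1 hy
        obtain ⟨rfl, rfl⟩ := List.cons.inj hj
        have := (List.getElem?_eq_some_iff.1 hy').1
        refine ⟨Or.inl trivial, ?_⟩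
        simp only [modify, if_true]
        omega

theorem modify_pathCol {p : List ℕ} (hp : t.IsNode p) :
    (t.modify a f l).pathCol p = t.pathCol p := by
  induction p with
  | nil => exact modify_col t a f l hp
  | cons i p ih => rw [pathCol, pathCol, ih hp.1, modify_col t a f l hp]

theorem modify_winning (h : t.Winning) : (t.modify a f l).Winning := by
  intro s hs
  have hn : ∀ n, t.IsNode (pos s n) := by
    intro n
    rcases (modify_isNode t a f l).1 (hs n) with h | ⟨y, hy⟩
    · exact h
    · exfalso
      have h' := (hs (n + 1)).2
      have hp : pos s n ≠ [] := by intro h0; simp [h0, extra] at hy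
      simp [modify, hp, hy] at h'
  simpa only [modify_col t a f l (hn _)] using h s hn

theorem modify_isRunTree {R : colObj C X ⊗ colObj C A ⟶ A} {a₀ : A} (h : t.IsRunTree R a₀)
    (ha : a ≤ a₀) (hf : ∀ y ∈ t.leaves, y.val ≤ f y) : (t.modify a f l).IsRunTree R a where
  root_label := rfl
  root_col := h.root_col
  inner p hp h0 := by
    by_cases hp0 : p = []
    · exact ⟨a, by subst hp0; rfl⟩
    rcases (modify_isNode t a f l).1 hp with hn | ⟨y, hy⟩
    · rw [modify_arity t a f l hn hp0] at h0
      obtain ⟨b, hb⟩ := h.inner p hn h0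
      exact ⟨b, by rw [modify_label t a f l hn hp0, hb]; rfl⟩
    · simp [modify, hp0, hy] at h0
  step p b hp hb := by
    rcases (modify_isNode t a f l).1 hp with hn | ⟨y, hy⟩
    · have key : ∀ b', t.label p = Sum.inr b' → b ≤ b' → R.rel
          ((t.modify a f l).childrenX p, (t.modify a f l).childrenA p) b := by
        intro b' hb' hbb'
        have ar : t.arity p ≤ (t.modify a f l).arity p := by
          by_cases hp0 : p = []
          · subst hp0
            simp [modify]
          · rw [modify_arity t a f l hn hp0]
        refine down R (h.step p b' hn hb') ⟨fun y hy => ?_, fun y hy => ?_⟩ hbb'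
        · obtain ⟨i, hi, hc, hl⟩ := (Bang.mem_ofSet _ y).1 hy
          have hin : t.IsNode (i :: p) := ⟨hn, hi⟩
          have hpc := hf ⟨t.pathCol (i :: p), y.val⟩ ⟨i :: p, hin, hl, rfl⟩
          refine ⟨⟨y.col, f ⟨t.pathCol (i :: p), y.val⟩⟩, (Bang.mem_ofSet _ _).2
            ⟨i, hi.trans_le ar, ?_, ?_⟩, rfl, hpc⟩
          · rw [modify_col t a f l hin, hc]
          · rw [modify_label t a f l hin (by simp), hl]
            rfl
        · obtain ⟨i, hi, hc, hl⟩ := (Bang.mem_ofSet _ y).1 hy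
          have hin : t.IsNode (i :: p) := ⟨hn, hi⟩
          refine ⟨y, (Bang.mem_ofSet _ _).2 ⟨i, hi.trans_le ar, ?_, ?_⟩, le_rfl⟩
          · rw [modify_col t a f l hin, hc]
          · rw [modify_label t a f l hin (by simp), hl]
            rfl
      by_cases hp0 : p = []
      · subst hp0
        obtain rfl : a = b := Sum.inr.inj hb
        exact key a₀ h.root_label ha
      · rw [modify_label t a f l hn hp0] at hb
        rcases hl : t.label p with x | b'
        · rw [hl] at hb
          cases hb
        · rw [hl] at hb
          obtain rfl : b' = b := Sum.inr.inj hb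
          exact key b' hl le_rfl
    · exfalso
      have hp0 : p ≠ [] := by rintro rfl; simp [extra] at hy
      simp [modify, hp0, hy] at hb

theorem modify_leaves {R : colObj C X ⊗ colObj C A ⟶ A} {a₀ : A} (h : t.IsRunTree R a₀)
    (hf : ∀ y ∈ t.leaves, (⟨y.col, f y⟩ : Box C X) ∈ l) :
    (t.modify a f l).leaves = {y | y ∈ l} := by
  ext y
  constructor
  · rintro ⟨p, hp, hl, hc⟩
    have hp0 : p ≠ [] := by rintro rfl; cases hl
    rcases (modify_isNode t a f l).1 hp with hn | ⟨z, hz⟩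
    · rw [modify_label t a f l hn hp0] at hl
      rw [modify_pathCol t a f l hn] at hc
      rcases hx : t.label p with x | b
      · rw [hx] at hl
        have := hf ⟨t.pathCol p, x⟩ ⟨p, hn, hx, rfl⟩
        have e : f ⟨t.pathCol p, x⟩ = y.val := Sum.inl.inj hl
        rw [e] at this
        have e' : (⟨t.pathCol p, y.val⟩ : Box C X) = y := Box.ext hc rfl
        exact e' ▸ this
      · rw [hx] at hl
        cases hl
    · obtain ⟨j, rfl, hj⟩ := (t.extra_eq_some l).1 hz
      have e : z = y := by
        refine Box.ext ?_ ?_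
        · rw [← hc]
          simp [pathCol, modify, hj, extra, h.root_col]
        · simpa [modify, hz] using hl
      exact e ▸ List.mem_of_getElem? hj
  · intro hy
    obtain ⟨j, hj⟩ := List.mem_iff_getElem?.1 hy
    have hz := (t.extra_eq_some l).2 ⟨j, rfl, hj⟩
    refine ⟨[t.arity [] + j], (modify_isNode t a f l).2 (Or.inr ⟨y, hz⟩), ?_, ?_⟩
    · simp [modify, hz]
    · simp [pathCol, modify, hj, extra, h.root_col]

end ColTree

/-- The fixpoint operator. -/
def fixOp (C : Finset ℕ) (X A : FinScottL.{u}) (R : colObj C X ⊗ colObj C A ⟶ A) :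
    colObj C X ⟶ A :=
  Hom.mk (fixRel R) (by
    classical
    rintro s s' a a' ⟨t, ht, hw, hl⟩ h₁ h₂
    have hex : ∀ y : Box C X, ∃ x : X, y ∈ t.leaves →
        y.val ≤ x ∧ (⟨y.col, x⟩ : Box C X) ∈ (id s' : Bang (Box C X)).elems.toList := by
      intro y
      by_cases hy : y ∈ t.leaves
      · have hy' := hy
        rw [hl] at hy'
        obtain ⟨z, hz, hc, hyz⟩ := h₁ y hy'
        refine ⟨z.val, fun _ => ⟨hyz, Finset.mem_toList.2 ?_⟩⟩
        have e : (⟨y.col, z.val⟩ : Box C X) = z := Box.ext hc rfl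
        exact e ▸ hz
      · exact ⟨y.val, fun h => (hy h).elim⟩
    choose f hf using hex
    refine ⟨t.modify a' f (id s' : Bang (Box C X)).elems.toList,
      t.modify_isRunTree _ _ _ ht h₂ fun y hy => (hf y hy).1, t.modify_winning _ _ _ hw, ?_⟩
    rw [t.modify_leaves _ _ _ ht fun y hy => (hf y hy).2]
    ext y
    exact Finset.mem_toList)

/-! ### The Kleisli category of `!□` and its cartesian closed structure -/

theorem comp_der_of {C : Finset ℕ} {A B : Cokleisli (colBang.{u} C)} {D : FinScottL.{u}}
    (f : A ⟶ B) (R : B.of ⟶ D) :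
    (f ≫ (Cokleisli.Hom.mk (colDer C B.of ≫ R) : B ⟶ Cokleisli.mk (colBang C) D)).of = f.of ≫ R := by
  have h₁ := (colBang C).ε.naturality f.of
  have h₂ := (colBang C).left_counit A.of
  change (colBang C).δ.app A.of ≫ (colBang C).map f.of ≫ (colBang C).ε.app B.of ≫ R = _
  rw [← Category.assoc ((colBang C).map f.of), h₁, Category.assoc, ← Category.assoc, h₂,
    Category.id_comp]
  rfl

open Limits in
/-- The product of `A` and `B` in the Kleisli category is `A & B`. -/
def kleisliProd {C : Finset ℕ} (A B : Cokleisli (colBang.{u} C)) : LimitCone (Limits.pair A B) where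
  cone := BinaryFan.mk (P := Cokleisli.mk (colBang C) (withObj A.of B.of))
    (Cokleisli.Hom.mk (colDer C _ ≫ proj₁ A.of B.of))
    (Cokleisli.Hom.mk (colDer C _ ≫ proj₂ A.of B.of))
  isLimit := BinaryFan.IsLimit.mk _
    (fun f g => Cokleisli.Hom.mk (FinScottL.pair f.of g.of))
    (fun f g => Cokleisli.hom_ext _ (by
      exact (comp_der_of _ _).trans (pair_proj₁ _ _)))
    (fun f g => Cokleisli.hom_ext _ (by
      exact (comp_der_of _ _).trans (pair_proj₂ _ _)))
    (fun f g m h₁ h₂ => Cokleisli.hom_ext _ (with_ext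
      (by
        rw [pair_proj₁]
        exact (comp_der_of _ _).symm.trans (congrArg Cokleisli.Hom.of h₁))
      (by
        rw [pair_proj₂]
        exact (comp_der_of _ _).symm.trans (congrArg Cokleisli.Hom.of h₂))))

open Limits in
/-- The terminal object of the Kleisli category is `⊤`. -/
def kleisliTop (C : Finset ℕ) : LimitCone (Functor.empty.{0} (Cokleisli (colBang.{u} C))) where
  cone := asEmptyCone (Cokleisli.mk (colBang C) top)
  isLimit := IsTerminal.ofUniqueHom
    (fun _ => Cokleisli.Hom.mk (Hom.mk (fun _ _ => False) (fun h _ _ => h)))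
    (fun _ _ => Cokleisli.hom_ext _ (hom_ext fun _ b => PEmpty.elim b))

instance (C : Finset ℕ) : CartesianMonoidalCategory (Cokleisli (colBang.{u} C)) :=
  CartesianMonoidalCategory.ofChosenFiniteProducts (kleisliTop C) kleisliProd

/-- `A ⊸ B`, that is, `Aᵒᵖ × B`. -/
def lolli (A B : FinScottL.{u}) : FinScottL.{u} := ⟨Aᵒᵈ × B⟩

/-- Morphisms `A ⊗ B ⟶ D` are the same as morphisms `B ⟶ (A ⊸ D)`. -/
def linCurry (A B D : FinScottL.{u}) : (A ⊗ B ⟶ D) ≃ (B ⟶ lolli A D) where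
  toFun R := Hom.mk (fun (b : B) (p : Aᵒᵈ × D) => R.rel (OrderDual.ofDual p.1, b) p.2)
    (fun h h₁ h₂ => down R h ⟨h₂.1, h₁⟩ h₂.2)
  invFun S := Hom.mk (fun (p : A × B) (d : D) => S.rel p.2 (OrderDual.toDual p.1, d))
    (fun h h₁ h₂ => down S h h₁.2 ⟨h₁.1, h₂⟩)
  left_inv _ := rfl
  right_inv _ := rfl

section

variable {C : Finset ℕ}

theorem seely_hom_comp_rel {A B D : FinScottL.{u}} (R : colObj C (withObj A B) ⟶ D)
    (p : Bang (Box C A) × Bang (Box C B)) (d : D) :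
    Hom.rel ((seely A B).hom ≫ R) p d ↔ R.rel (Bang.merge p.1 p.2) d :=
  ofMap_comp_rel (A := tensor (colObj C A) (colObj C B)) (B := colObj C (withObj A B)) _ R p d

theorem comp_seely_hom_rel {A B D : FinScottL.{u}} (R : D ⟶ colObj C A ⊗ colObj C B)
    (d : D) (s : Bang (Box C (A ⊕ B))) :
    Hom.rel (R ≫ (seely A B).hom) d s ↔ R.rel d (s.left, s.right) :=
  comp_ofIso_rel (B := tensor (colObj C A) (colObj C B)) (D := colObj C (withObj A B)) R
    (mergeIso A B) d s

theorem colMap_proj₂_comp_rel {A B D : FinScottL.{u}} (R : colObj C B ⟶ D)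
    (s : Bang (Box C (A ⊕ B))) (d : D) :
    Hom.rel (colMap C (proj₂ A B) ≫ R) s d ↔ R.rel s.right d := by
  constructor
  · rintro ⟨t, h, h'⟩
    refine down R h' (fun y hy => ?_) le_rfl
    obtain ⟨⟨c, a | b⟩, hx, hc, hxy⟩ := h y hy
    · exact (Sum.not_inr_le_inl hxy).elim
    · exact ⟨⟨c, b⟩, Bang.mem_right.2 hx, hc.symm, Sum.inr_le_inr_iff.1 hxy⟩
  · intro h
    refine ⟨s.right, fun y hy => ⟨⟨y.col, Sum.inr y.val⟩, Bang.mem_right.1 hy, rfl, ?_⟩, h⟩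
    exact (le_rfl : (Sum.inr y.val : A ⊕ B) ≤ Sum.inr y.val)

theorem unpaint_merge_right {α β : Type u} [Preorder α] [Preorder β] [Finite α] [Finite β]
    (c : Col C) (s : Bang (Box C α)) (t : Bang (Box C β)) :
    (Bang.unpaint c (Bang.merge s t)).right = Bang.unpaint c t := by
  refine Bang.ext fun z => (Bang.mem_ofSet _ z).trans ((Bang.mem_ofSet _ _).trans
    (Iff.trans ?_ (Bang.mem_ofSet _ z).symm))
  constructor
  · rintro ⟨⟨d, a | b⟩, hx, hc, hzx⟩
    · exact (Sum.not_inr_le_inl hzx).elim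
    · exact ⟨⟨d, b⟩, Bang.inr_mem_merge.1 hx, hc, Sum.inr_le_inr_iff.1 hzx⟩
  · rintro ⟨⟨d, b⟩, hx, hc, hzx⟩
    exact ⟨⟨d, Sum.inr b⟩, Bang.inr_mem_merge.2 hx, hc, Sum.inr_le_inr_iff.2 hzx⟩

theorem seely_prom {A B B' : FinScottL.{u}} (f : colObj C B ⟶ B') :
    (seely A B).hom ≫ prom (pair (colDer C (withObj A B) ≫ proj₁ A B)
      (colMap C (proj₂ A B) ≫ f)) = colObj C A ◁ prom f ≫ (seely A B').hom := by
  refine hom_ext fun p s => (seely_hom_comp_rel _ p s).trans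
    (((prom_rel _ _ _).trans ?_).trans (comp_seely_hom_rel _ p s).symm)
  constructor
  · intro h
    refine ⟨?_, (prom_rel f p.2 (Bang.right s)).2 ?_⟩
    · rintro ⟨c, a⟩ hx
      obtain ⟨z, hz, haz⟩ := h ⟨c, Sum.inl a⟩ (Bang.mem_left.1 hx)
      obtain ⟨w, hw, hc, hzw⟩ := (colDer_rel _ _).1 hz
      obtain ⟨⟨d, a' | b'⟩, hv, hvw, hvw'⟩ := (Bang.mem_ofSet _ _).1 hw
      · exact ⟨⟨d, a'⟩, Bang.inl_mem_merge.1 hv, by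
          rw [hc, sup_bot_eq] at hvw; exact hvw.symm,
          Sum.inl_le_inl_iff.1 (le_trans haz (hzw.trans hvw'))⟩
      · exact (Sum.not_inl_le_inr (le_trans haz (hzw.trans hvw'))).elim
    · rintro ⟨c, b⟩ hx
      have := (colMap_proj₂_comp_rel f _ b).1 (h ⟨c, Sum.inr b⟩ (Bang.mem_right.1 hx))
      exact (congrArg (fun w => f.rel w b) (unpaint_merge_right c p.1 p.2)).mp this
  · rintro ⟨h₁, h₂⟩ ⟨c, a | b⟩ hy
    · obtain ⟨⟨d, a'⟩, hx, hc, hax⟩ := h₁ ⟨c, a⟩ (Bang.mem_left.2 hy)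
      refine ⟨Sum.inl a, (colDer_rel _ _).2 ⟨⟨⊥, Sum.inl a⟩, (Bang.mem_ofSet _ _).2
        ⟨⟨d, Sum.inl a'⟩, Bang.inl_mem_merge.2 hx, ?_, Sum.inl_le_inl_iff.2 hax⟩, rfl, le_rfl⟩,
        (le_rfl : (Sum.inl a : A ⊕ B) ≤ Sum.inl a)⟩
      rw [sup_bot_eq]
      exact hc.symm
    · refine (colMap_proj₂_comp_rel f _ b).2 ?_
      refine (congrArg (fun w => f.rel w b) (unpaint_merge_right c p.1 p.2)).mpr ?_
      exact (prom_rel f p.2 (Bang.right s)).1 h₂ ⟨c, b⟩ (Bang.mem_right.2 hy)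

theorem whisker_of (A : Cokleisli (colBang.{u} C)) {B B' : Cokleisli (colBang.{u} C)}
    (f : B ⟶ B') :
    (A ◁ f).of = pair (colDer C (withObj A.of B.of) ≫ proj₁ A.of B.of)
      (colMap C (proj₂ A.of B.of) ≫ f.of) := by
  refine with_ext ?_ ?_
  · refine Eq.trans ?_ (pair_proj₁ _ _).symm
    refine (comp_der_of (A ◁ f) (proj₁ A.of B'.of)).symm.trans ?_
    exact congrArg Cokleisli.Hom.of (CartesianMonoidalCategory.whiskerLeft_fst A f)
  · refine Eq.trans ?_ (pair_proj₂ _ _).symm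
    refine (comp_der_of (A ◁ f) (proj₂ A.of B'.of)).symm.trans ?_
    refine (congrArg Cokleisli.Hom.of (CartesianMonoidalCategory.whiskerLeft_snd A f)).trans ?_
    have h := (colBang C).right_counit (withObj A.of B.of)
    change (colBang C).δ.app (withObj A.of B.of) ≫ (colBang C).map
      ((colBang C).ε.app (withObj A.of B.of) ≫ proj₂ A.of B.of) ≫ f.of = _
    rw [Functor.map_comp, Category.assoc, ← Category.assoc, h, Category.id_comp]
    rfl

/-- Currying in the Kleisli category: the exponential of `A` and `Y` is `!□A ⊸ Y`. -/
noncomputable def kleisliCurry (A X Y : Cokleisli (colBang.{u} C)) :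
    ((tensorLeft A).obj X ⟶ Y) ≃ (X ⟶ Cokleisli.mk (colBang C) (lolli (colObj C A.of) Y.of)) where
  toFun f := Cokleisli.Hom.mk (linCurry _ _ _ ((seely A.of X.of).hom ≫ f.of))
  invFun g := Cokleisli.Hom.mk ((seely A.of X.of).inv ≫ (linCurry _ _ _).symm g.of)
  left_inv f := Cokleisli.hom_ext _ (by
    exact (congrArg ((seely A.of X.of).inv ≫ ·) (Equiv.symm_apply_apply _ _)).trans
      (Iso.inv_hom_id_assoc _ _))
  right_inv g := Cokleisli.hom_ext _ (by
    exact (congrArg (linCurry _ _ _) (Iso.hom_inv_id_assoc _ _)).trans (Equiv.apply_symm_apply _ _))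

theorem linCurry_natural {A B B' D : FinScottL.{u}} (f : B ⟶ B') (g : A ⊗ B' ⟶ D) :
    linCurry A B D (A ◁ f ≫ g) = f ≫ linCurry A B' D g :=
  hom_ext fun b p => by
    constructor
    · rintro ⟨⟨a', b'⟩, ⟨ha, hb⟩, h⟩
      exact ⟨b', hb, down g h ⟨ha, le_rfl⟩ le_rfl⟩
    · rintro ⟨b', hb, h⟩
      exact ⟨(OrderDual.ofDual p.1, b'), ⟨le_rfl, hb⟩, h⟩

theorem kleisliCurry_natural (A : Cokleisli (colBang.{u} C)) (X' X Y : Cokleisli (colBang.{u} C))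
    (f : X' ⟶ X) (g : (tensorLeft A).obj X ⟶ Y) :
    kleisliCurry A X' Y ((tensorLeft A).map f ≫ g) = f ≫ kleisliCurry A X Y g := by
  refine Cokleisli.hom_ext _ ?_
  have h₁ : (seely A.of X'.of).hom ≫ ((tensorLeft A).map f ≫ g).of =
      colObj C A.of ◁ prom f.of ≫ (seely A.of X.of).hom ≫ g.of := by
    have h := congrArg (· ≫ g.of) (seely_prom (A := A.of) f.of)
    rw [← whisker_of A f] at h
    exact (congrArg ((seely A.of X'.of).hom ≫ ·) (Category.assoc _ _ _).symm).trans
      ((Category.assoc _ _ _).symm.trans (h.trans (Category.assoc _ _ _)))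
  refine (congrArg (linCurry _ _ _) h₁).trans ((linCurry_natural _ _).trans ?_)
  exact Category.assoc _ _ _

noncomputable instance : MonoidalClosed (Cokleisli (colBang.{u} C)) where
  closed A :=
    { rightAdj := Adjunction.rightAdjointOfEquiv (kleisliCurry A) (kleisliCurry_natural A)
      adj := Adjunction.adjunctionOfEquivRight (kleisliCurry A) (kleisliCurry_natural A) }

end

/-- The fixpoint operator on the Kleisli category: a morphism from the product of `X` and `A`
is turned into a morphism from `!□X ⊗ !□A` by means of the Seely isomorphism. -/
noncomputable def kleisliFix (C : Finset ℕ) (X A : Cokleisli (colBang.{u} C)) (f : X ⊗ A ⟶ A) :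
    X ⟶ A :=
  Cokleisli.Hom.mk (fixOp C X.of A.of ((seely X.of A.of).hom ≫ f.of))

end FinScottL

/-! ### Conway operators on cartesian categories -/

open CartesianMonoidalCategory in
/-- Conway operators on a category with finite products. -/
structure IsCartesianConwayOperator {K : Type u} [Category.{v} K] [CartesianMonoidalCategory K]
    (Y : ∀ X A : K, (X ⊗ A ⟶ A) → (X ⟶ A)) : Prop where
  natural : ∀ {X Z A : K} (g : X ⟶ Z) (f : Z ⊗ A ⟶ A), Y X A (g ▷ A ≫ f) = g ≫ Y Z A f
  fixpoint : ∀ {X A : K} (f : X ⊗ A ⟶ A), Y X A f = lift (𝟙 X) (Y X A f) ≫ f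
  dinatural : ∀ {X A B : K} (f : X ⊗ B ⟶ A) (g : X ⊗ A ⟶ B),
    Y X A (lift (fst X A) g ≫ f) = lift (𝟙 X) (Y X B (lift (fst X B) f ≫ g)) ≫ f
  diagonal : ∀ {X A : K} (f : (X ⊗ A) ⊗ A ⟶ A),
    Y X A (Y (X ⊗ A) A f) = Y X A (lift (𝟙 (X ⊗ A)) (snd X A) ≫ f)

/-! ### The simply-typed `λY`-calculus and its interpretation -/

namespace LambdaY

/-- Simple types. -/
inductive Ty : Type
  | o : Ty
  | arr : Ty → Ty → Ty

/-- Variables of a context, as de Bruijn indices. -/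
inductive Var : List Ty → Ty → Type
  | zero {Γ : List Ty} {σ : Ty} : Var (σ :: Γ) σ
  | succ {Γ : List Ty} {σ τ : Ty} : Var Γ τ → Var (σ :: Γ) τ

/-- Simply-typed `λY`-terms in context, with constants `c : S` of type `ty c`. -/
inductive Tm {S : Type w} (ty : S → Ty) : List Ty → Ty → Type w
  | var {Γ : List Ty} {τ : Ty} : Var Γ τ → Tm ty Γ τ
  | const {Γ : List Ty} (c : S) : Tm ty Γ (ty c)
  | lam {Γ : List Ty} {σ τ : Ty} : Tm ty (σ :: Γ) τ → Tm ty Γ (.arr σ τ)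
  | app {Γ : List Ty} {σ τ : Ty} : Tm ty Γ (.arr σ τ) → Tm ty Γ σ → Tm ty Γ τ
  | fix {Γ : List Ty} (σ : Ty) : Tm ty Γ (.arr (.arr σ σ) σ)

section

variable {S : Type w} {ty : S → Ty}

/-- Extension of a renaming under a binder. -/
def liftRen {Γ Δ : List Ty} {σ : Ty} (r : ∀ τ, Var Γ τ → Var Δ τ) :
    ∀ τ, Var (σ :: Γ) τ → Var (σ :: Δ) τ
  | _, .zero => .zero
  | _, .succ x => .succ (r _ x)

def Tm.ren : ∀ {Γ Δ : List Ty} {τ : Ty}, (∀ τ, Var Γ τ → Var Δ τ) → Tm ty Γ τ → Tm ty Δ τ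
  | _, _, _, r, .var x => .var (r _ x)
  | _, _, _, _, .const c => .const c
  | _, _, _, r, .lam t => .lam (t.ren (liftRen r))
  | _, _, _, r, .app t s => .app (t.ren r) (s.ren r)
  | _, _, _, _, .fix σ => .fix σ

/-- Weakening. -/
def Tm.wk {Γ : List Ty} {σ τ : Ty} (t : Tm ty Γ τ) : Tm ty (σ :: Γ) τ :=
  t.ren fun _ x => .succ x

/-- Extension of a substitution under a binder. -/
def liftSub {Γ Δ : List Ty} {σ : Ty} (r : ∀ τ, Var Γ τ → Tm ty Δ τ) :
    ∀ τ, Var (σ :: Γ) τ → Tm ty (σ :: Δ) τ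
  | _, .zero => .var .zero
  | _, .succ x => (r _ x).wk

/-- Simultaneous capture-avoiding substitution. -/
def Tm.sub : ∀ {Γ Δ : List Ty} {τ : Ty}, (∀ τ, Var Γ τ → Tm ty Δ τ) → Tm ty Γ τ → Tm ty Δ τ
  | _, _, _, r, .var x => r _ x
  | _, _, _, _, .const c => .const c
  | _, _, _, r, .lam t => .lam (t.sub (liftSub r))
  | _, _, _, r, .app t s => .app (t.sub r) (s.sub r)
  | _, _, _, _, .fix σ => .fix σ

/-- The substitution of `s` for the last variable. -/
def single {Γ : List Ty} {σ : Ty} (s : Tm ty Γ σ) : ∀ τ, Var (σ :: Γ) τ → Tm ty Γ τ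
  | _, .zero => s
  | _, .succ x => .var x

/-- The equational theory of the `λY`-calculus: the congruence generated by `β`, `η` and
`Y M = M (Y M)`. -/
inductive Conv : ∀ {Γ : List Ty} {τ : Ty}, Tm ty Γ τ → Tm ty Γ τ → Prop
  | refl {Γ : List Ty} {τ : Ty} (t : Tm ty Γ τ) : Conv t t
  | symm {Γ : List Ty} {τ : Ty} {t s : Tm ty Γ τ} : Conv t s → Conv s t
  | trans {Γ : List Ty} {τ : Ty} {t s r : Tm ty Γ τ} : Conv t s → Conv s r → Conv t r
  | lam {Γ : List Ty} {σ τ : Ty} {t t' : Tm ty (σ :: Γ) τ} : Conv t t' → Conv (.lam t) (.lam t')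
  | app {Γ : List Ty} {σ τ : Ty} {t t' : Tm ty Γ (.arr σ τ)} {s s' : Tm ty Γ σ} :
      Conv t t' → Conv s s' → Conv (.app t s) (.app t' s')
  | beta {Γ : List Ty} {σ τ : Ty} (t : Tm ty (σ :: Γ) τ) (s : Tm ty Γ σ) :
      Conv (.app (.lam t) s) (t.sub (single s))
  | eta {Γ : List Ty} {σ τ : Ty} (t : Tm ty Γ (.arr σ τ)) :
      Conv (.lam (.app t.wk (.var .zero))) t
  | delta {Γ : List Ty} {σ : Ty} (t : Tm ty Γ (.arr σ σ)) :
      Conv (.app (.fix σ) t) (.app t (.app (.fix σ) t))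

end

section

variable {K : Type u} [Category.{v} K] [CartesianMonoidalCategory K] [MonoidalClosed K]

open CartesianMonoidalCategory

/-- The interpretation of simple types, given the interpretation of the ground type. -/
def Ty.sem (O : K) : Ty → K
  | .o => O
  | .arr σ τ => (ihom (Ty.sem O σ)).obj (Ty.sem O τ)

/-- Contexts are interpreted as products. -/
def ctxSem (O : K) : List Ty → K
  | [] => 𝟙_ K
  | σ :: Γ => σ.sem O ⊗ ctxSem O Γ

/-- Variables are interpreted as projections. -/
def Var.sem (O : K) : ∀ {Γ : List Ty} {τ : Ty}, Var Γ τ → (ctxSem O Γ ⟶ τ.sem O)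
  | _, _, .zero => fst _ _
  | _, _, .succ x => snd _ _ ≫ Var.sem O x

/-- The internal fixpoint combinator `(A ⇒ A) ⇒ A` at a parameter `X`: the currying of `Y` applied
to evaluation. -/
def fixSem (Y : ∀ X A : K, (X ⊗ A ⟶ A) → (X ⟶ A)) (X A : K) :
    X ⟶ (ihom ((ihom A).obj A)).obj A :=
  MonoidalClosed.curry (Y ((ihom A).obj A ⊗ X) A
    (lift (snd _ _) (fst _ _ ≫ fst _ _) ≫ (ihom.ev A).app A))

/-- The standard interpretation of `λY`-terms in a cartesian closed category with an operator `Y`,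
given the interpretations of the ground type and of the constants. -/
def Tm.sem (Y : ∀ X A : K, (X ⊗ A ⟶ A) → (X ⟶ A)) (O : K) {S : Type w} {ty : S → Ty}
    (κ : ∀ c, 𝟙_ K ⟶ (ty c).sem O) :
    ∀ {Γ : List Ty} {τ : Ty}, Tm ty Γ τ → (ctxSem O Γ ⟶ τ.sem O)
  | _, _, .var x => x.sem O
  | _, _, .const c => toUnit _ ≫ κ c
  | _, _, .lam t => MonoidalClosed.curry (t.sem Y O κ)
  | _, _, .app t s => lift (s.sem Y O κ) (t.sem Y O κ) ≫ (ihom.ev _).app _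
  | _, _, .fix σ => fixSem Y _ (σ.sem O)

/-- A cartesian closed category with an operator `Y` is a model of the `λY`-calculus when its
interpretation identifies convertible terms. -/
def IsModel (Y : ∀ X A : K, (X ⊗ A ⟶ A) → (X ⟶ A)) : Prop :=
  ∀ (O : K) {S : Type w} (ty : S → Ty) (κ : ∀ c, 𝟙_ K ⟶ (ty c).sem O) {Γ : List Ty} {τ : Ty}
    (t s : Tm ty Γ τ), Conv t s → t.sem Y O κ = s.sem Y O κ

end

end LambdaY

/-! The operator `fixOp` computes the winning positions of a parity game (`fixOp_rel_iff`). At `(s,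
a)` the player justifies `a` by a finite set `v` such that `R` relates `(s, v)` to `a`; the opponent
picks `(c, b)` in `v`, and the play goes on from `(Bang.unpaint c s, b)`. The first component
records which leaves are still allowed: a leaf of colour `d` below the new position has colour `max
c d` seen from the old one. A winning run-tree is a strategy whose memory is the current node, and a
winning strategy unfolds to a run-tree. Strategies have arbitrary memory, so neither determinacy nor
positional strategies are needed.

Naturality is then a bisimulation between two games, because promotion commutes with unpainting
(`unpaint_promVal`). The fixpoint identity says that a position is winning iff some move leads only
to winning positions (`win_iff`).

Dinaturality and the diagonal identity rest on acceleration (`win_accel_iff`). Distinguish two kinds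
of moves and treat a stretch of play up to the first move of the second kind as a single move,
coloured by its maximum. This does not change the winner: if there are infinitely many stretches,
the parity condition depends only on their maxima (`parity_blocks`), and a stretch which never ends
is judged by the parity condition of the inner game. The game of `star f g` is the acceleration of
the game which alternates between `f` and `g`, and the unaccelerated game is symmetric in `f` and
`g`; this gives dinaturality. For the diagonal identity, the nested fixpoint is the acceleration of
the game where the two arguments of `f` in `A` give the two kinds of moves, and the fixpoint on the
diagonal is the same game with the kinds forgotten.

The identities in the Kleisli category are obtained by transport along the Seely isomorphisms. For
the `λY`-calculus, naturality gives the substitution lemma and the fixpoint identity gives the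
unfolding of `Y`, the rest being the cartesian closed structure. -/

namespace FinScottL

/-! ### The parity condition -/

section Parity

variable {C : Finset ℕ}

open Filter

/-- Some non-neutral colour occurs infinitely often, and the greatest such colour is even. -/
def Parity (c : ℕ → Col C) : Prop :=
  ∃ k : C, (∃ᶠ n in atTop, c n = (k : Col C)) ∧
    (∀ d : C, (∃ᶠ n in atTop, c n = (d : Col C)) → d ≤ k) ∧ Even (k : ℕ)

/-- This form mentions colours only through the predicates `· ≤ k` and `· < k`, which hold of a
maximum iff they hold of both of its arguments. Such predicates can be tested on blocks of colours.
-/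
theorem parity_iff {c : ℕ → Col C} : Parity c ↔ ∃ k : C, Even (k : ℕ) ∧
    (∀ᶠ n in atTop, c n ≤ (k : Col C)) ∧ ¬ ∀ᶠ n in atTop, c n < (k : Col C) := by
  constructor
  · rintro ⟨k, hk, hd, he⟩
    refine ⟨k, he, ?_, fun h => ?_⟩
    · have : ∀ d : C, ¬ d ≤ k → ∀ᶠ n in atTop, c n ≠ (d : Col C) := fun d hdk =>
        not_frequently.1 fun h => hdk (hd d h)
      -- As `C` is finite, the bounds after which each colour not below `k` disappears have a common
      -- one.
      have h' : ∀ᶠ n in atTop, ∀ d : C, ¬ d ≤ k → c n ≠ (d : Col C) := by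
        rw [eventually_all]
        intro d
        by_cases hdk : d ≤ k
        · exact Eventually.of_forall fun _ h => (h hdk).elim
        · filter_upwards [this d hdk] with n hn _ using hn
      filter_upwards [h'] with n hn
      rcases hc : c n with _ | d
      · exact bot_le
      · by_contra hlt
        exact hn d (fun h => hlt (WithBot.coe_le_coe.2 h)) hc
    · obtain ⟨n, hn, hn'⟩ := (hk.and_eventually h).exists
      exact hn'.ne hn
  · rintro ⟨k, he, hle, hlt⟩
    refine ⟨k, ?_, fun d hd => ?_, he⟩
    · refine ((not_eventually.1 hlt).and_eventually hle).mono fun n hn => ?_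
      exact le_antisymm hn.2 (not_lt.1 hn.1)
    · obtain ⟨n, hn, hn'⟩ := (hd.and_eventually hle).exists
      exact WithBot.coe_le_coe.1 (hn ▸ hn')

/-- Among the predicates `D`, only `· ≤ k` and `· < k` for `k` in `C` are needed. The second holds
at `⊥` because the neutral colour is strictly below all of `C`. -/
theorem parity_congr {c d : ℕ → Col C} (h : ∀ D : Col C → Prop, D ⊥ →
    (∀ x y, D (max x y) ↔ D x ∧ D y) →
      ((∀ᶠ n in atTop, D (c n)) ↔ ∀ᶠ n in atTop, D (d n))) : Parity c ↔ Parity d := by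
  rw [parity_iff, parity_iff]
  refine exists_congr fun k => and_congr_right fun _ => and_congr ?_ (not_congr ?_)
  · exact h (· ≤ (k : Col C)) bot_le fun _ _ => max_le_iff
  · exact h (· < (k : Col C)) (WithBot.bot_lt_coe k) fun _ _ => max_lt_iff

theorem parity_shift {c : ℕ → Col C} (k : ℕ) : Parity (fun n => c (n + k)) ↔ Parity c :=
  parity_congr fun D _ _ => by
    conv_rhs => rw [← map_add_atTop_eq_nat k, eventually_map]

/-- The parity condition only depends on the maxima of the colours on the consecutive blocks
delimited by an infinite set of times `cut`. Here `acc` is the maximum since the beginning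
of the current block. -/
theorem parity_blocks {d acc : ℕ → Col C} {cut : ℕ → Prop} (hinf : {n | cut n}.Infinite)
    (h₁ : ∀ n, cut n → acc (n + 1) = ⊥) (h₂ : ∀ n, ¬ cut n → acc (n + 1) = max (acc n) (d n)) :
    Parity (fun k => max (acc (Nat.nth cut k)) (d (Nat.nth cut k))) ↔ Parity d := by
  classical
  have next : ∀ n, ∃ m, n ≤ m ∧ cut m := fun n => by
    obtain ⟨m, hm, hnm⟩ := hinf.exists_gt n
    exact ⟨m, hnm.le, hm⟩
  -- The middle term tests `D` at the cuts `j` themselves instead of their ranks `k`; `Nat.count`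
  -- and `Nat.nth` translate between both.
  refine parity_congr fun D hbot hmax => Iff.trans
    (b := ∀ᶠ j in atTop, cut j → D (max (acc j) (d j))) ?_ ?_
  · simp only [eventually_atTop]
    constructor
    · rintro ⟨N, hN⟩
      refine ⟨Nat.nth cut N, fun j hj hs => ?_⟩
      have := hN (Nat.count cut j) ?_
      · rwa [Nat.nth_count hs] at this
      · rw [← Nat.count_nth_of_infinite hinf N]
        exact Nat.count_monotone _ hj
    · rintro ⟨N, hN⟩
      refine ⟨N, fun k hk => hN _ ?_ (Nat.nth_mem_of_infinite hinf k)⟩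
      exact hk.trans ((Nat.nth_strictMono hinf).le_apply)
  · simp only [eventually_atTop]
    constructor
    · rintro ⟨N, hN⟩
      refine ⟨N, fun j hj => ?_⟩
      have hfind := Nat.find_spec (next j)
      have hmin : ∀ i, j ≤ i → i < Nat.find (next j) → ¬ cut i := fun i hji hi hs =>
        Nat.find_min (next j) hi ⟨hji, hs⟩
      -- Without a cut from `j` up to `i`, the accumulator at `i` has absorbed `d j`, so `D`
      -- descends from the end of the block to `d j`.
      have hacc : ∀ i, j ≤ i → i ≤ Nat.find (next j) → D (max (acc i) (d i)) → D (d j) := by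
        intro i hji
        induction i, hji using Nat.le_induction with
        | base => exact fun _ h => ((hmax _ _).1 h).2
        | succ i hji ih =>
          intro hie h
          refine ih (by omega) ?_
          rw [h₂ i (hmin i hji (by omega))] at h
          exact ((hmax _ _).1 h).1
      exact hacc _ hfind.1 le_rfl (hN _ (hj.trans hfind.1) hfind.2)
    · rintro ⟨N, hN⟩
      -- After the first cut past `N` the accumulator contains no colour from before `N`.
      obtain ⟨m, hNm, hm⟩ := next N
      have hacc : ∀ i, m + 1 ≤ i → D (acc i) := by
        intro i hi
        induction i, hi using Nat.le_induction with
        | base => rw [h₁ m hm]; exact hbot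
        | succ i hi ih =>
          by_cases hs : cut i
          · rw [h₁ i hs]; exact hbot
          · rw [h₂ i hs]; exact (hmax _ _).2 ⟨ih, hN i (by omega)⟩
      exact ⟨m + 1, fun j hj _ => (hmax _ _).2 ⟨hacc j hj, hN j (by omega)⟩⟩

end Parity

/-! ### Parity games -/

section Game

variable {C : Finset ℕ}

/-- All infinite paths of a graph with coloured edges satisfy the parity condition. -/
def Sound {Q : Type u} (E : Q → Col C → Q → Prop) : Prop :=
  ∀ (q : ℕ → Q) (c : ℕ → Col C), (∀ n, E (q n) (c n) (q (n + 1))) → Parity c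

/-- The disjoint union of a family of coloured graphs. -/
inductive SigmaEdge {I : Type u} {Q : I → Type u} (E : ∀ i, Q i → Col C → Q i → Prop) :
    (Σ i, Q i) → Col C → (Σ i, Q i) → Prop
  | mk {i : I} {q : Q i} {c : Col C} {q' : Q i} : E i q c q' → SigmaEdge E ⟨i, q⟩ c ⟨i, q'⟩

/-- No edge changes the index, so an infinite path stays in one of the graphs. -/
theorem Sound.sigma {I : Type u} {Q : I → Type u} {E : ∀ i, Q i → Col C → Q i → Prop}
    (h : ∀ i, Sound (E i)) : Sound (SigmaEdge E) := by
  intro x c hx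
  have fst : ∀ n, (x n).1 = (x 0).1 := by
    intro n
    induction n with
    | zero => rfl
    | succ n ih =>
      have := hx n
      revert this ih
      generalize x n = y
      generalize x (n + 1) = z
      rintro ih ⟨-⟩
      exact ih
  have : ∀ n, ∃ r, x n = ⟨(x 0).1, r⟩ := fun n => ⟨fst n ▸ (x n).2, by
    refine Sigma.ext (fst n) ?_
    simp⟩
  choose r hr using this
  refine h _ r c fun n => ?_
  have := hx n
  rw [hr n, hr (n + 1)] at this
  revert this
  generalize r n = y
  generalize r (n + 1) = z
  rintro ⟨h⟩
  exact h

/-- A strategy in the game where, at the position `p`, the player chooses a set `V` of pairs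
of a colour and a position such that `M p V`, and the opponent chooses an element of `V`.
The strategy may have an arbitrary memory, and wins all infinite plays. -/
structure Strategy {P : Type u} (M : P → Set (Col C × P) → Prop) where
  State : Type u
  pos : State → P
  edge : State → Col C → State → Prop
  legal : ∀ q, M (pos q) {m | ∃ q', edge q m.1 q' ∧ pos q' = m.2}
  sound : Sound edge

/-- The winning positions of a game. -/
def Win {P : Type u} (M : P → Set (Col C × P) → Prop) (p : P) : Prop :=
  ∃ (σ : Strategy M) (q : σ.State), σ.pos q = p

/-- It is enough to win the infinite plays from an initial state. -/
theorem Win.of_root {P Q : Type u} {M : P → Set (Col C × P) → Prop} (pos : Q → P)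
    (E : Q → Col C → Q → Prop) (q₀ : Q)
    (legal : ∀ q, M (pos q) {m | ∃ q', E q m.1 q' ∧ pos q' = m.2})
    (sound : ∀ (q : ℕ → Q) (c : ℕ → Col C), q 0 = q₀ → (∀ n, E (q n) (c n) (q (n + 1))) →
      Parity c) : Win M (pos q₀) := by
  -- The states are cut down to the good ones. They are closed under edges since prefixing a path
  -- with an edge does not affect parity, so every move of the opponent from a good state is still
  -- answered.
  let Good (q₁ : Q) : Prop := ∀ (q : ℕ → Q) (c : ℕ → Col C), q 0 = q₁ →
    (∀ n, E (q n) (c n) (q (n + 1))) → Parity c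
  have step : ∀ q c q', Good q → E q c q' → Good q' := by
    intro q c q' hq hE x d hx hE'
    refine (parity_shift (c := fun n => Nat.casesOn n c d) 1).2
      (hq (fun n => Nat.casesOn n q x) _ rfl fun n => ?_)
    cases n with
    | zero =>
      change E q c (x 0)
      rw [hx]
      exact hE
    | succ n => exact hE' n
  refine ⟨⟨{q // Good q}, fun q => pos q.1, fun q c q' => E q.1 c q'.1, fun q => ?_,
    fun q c h => (q 0).2 (fun n => (q n).1) c rfl h⟩, ⟨q₀, sound⟩, rfl⟩
  convert legal q.1 using 1
  ext m
  exact ⟨fun ⟨q', h, k⟩ => ⟨q'.1, h, k⟩, fun ⟨q', h, k⟩ => ⟨⟨q', step _ _ _ q.2 h⟩, h, k⟩⟩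

/-- Winning is transported along simulations. -/
theorem Win.simulate {P P' : Type u} {M : P → Set (Col C × P) → Prop}
    {M' : P' → Set (Col C × P') → Prop} (S : P → P' → Prop)
    (h : ∀ p p' V, S p p' → M p V → M' p' {m | ∃ y, (m.1, y) ∈ V ∧ S y m.2}) {p : P} {p' : P'}
    (hw : Win M p) (hp : S p p') : Win M' p' := by
  obtain ⟨σ, q₀, rfl⟩ := hw
  -- The memory pairs a state of `σ` with a position of the second game related to its own. Edges
  -- constrain only the state of `σ`, hence the paths project to paths of `σ`.
  refine ⟨⟨{x : σ.State × P' // S (σ.pos x.1) x.2}, fun x => x.1.2,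
    fun x c y => σ.edge x.1.1 c y.1.1, fun x => ?_,
    fun x c hx => σ.sound (fun n => (x n).1.1) c hx⟩, ⟨(q₀, p'), hp⟩, rfl⟩
  convert h _ _ _ x.2 (σ.legal x.1.1) using 1
  ext m
  constructor
  · rintro ⟨y, hy, hm⟩
    exact ⟨_, ⟨_, hy, rfl⟩, hm ▸ y.2⟩
  · rintro ⟨_, ⟨q, hq, rfl⟩, hS⟩
    exact ⟨⟨(q, m.2), hS⟩, hq, rfl⟩

/-- The player may enlarge the sets chosen. -/
def MoveMono {P : Type u} (M : P → Set (Col C × P) → Prop) : Prop :=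
  ∀ ⦃p V V'⦄, V ⊆ V' → M p V → M p V'

/-- For the converse, strategies chosen for all winning positions are put side by side, and a new
initial state `none` is added for the first move. -/
theorem win_iff {P : Type u} {M : P → Set (Col C × P) → Prop} (hM : MoveMono M) {p : P} :
    Win M p ↔ M p {m | Win M m.2} := by
  constructor
  · rintro ⟨σ, q, rfl⟩
    refine hM ?_ (σ.legal q)
    rintro ⟨c, _⟩ ⟨q', -, rfl⟩
    exact ⟨σ, q', rfl⟩
  · intro h
    choose σ r hr using fun p : {p // Win M p} => p.2
    -- All edges end in `some`, so a path is inside the disjoint union from time `1` on. From `none`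
    -- every edge of this form is allowed, which is harmless because moves may be enlarged.
    let E : Option (Σ p, (σ p).State) → Col C → Option (Σ p, (σ p).State) → Prop :=
      fun x c y => ∃ z, y = some z ∧ ∀ w, x = some w → SigmaEdge (fun p => (σ p).edge) w c z
    refine ⟨⟨Option (Σ p, (σ p).State), fun x => x.elim p fun y => (σ y.1).pos y.2, E, ?_, ?_⟩,
      none, rfl⟩
    · rintro (_ | ⟨p', q⟩)
      · refine hM ?_ h
        rintro ⟨c, p'⟩ hp'
        exact ⟨some ⟨⟨p', hp'⟩, r _⟩, ⟨_, rfl, fun w hw => by cases hw⟩, hr ⟨p', hp'⟩⟩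
      · refine hM ?_ ((σ p').legal q)
        rintro ⟨c, _⟩ ⟨q', hq', rfl⟩
        refine ⟨some ⟨p', q'⟩, ⟨_, rfl, fun w hw => ?_⟩, rfl⟩
        obtain rfl := Option.some.inj hw
        exact ⟨hq'⟩
    · intro x c hx
      choose z hz hE using hx
      exact (parity_shift 1).1 (Sound.sigma (fun p => (σ p).sound) z _ fun n => hE _ _ (hz n))

/-! ### Acceleration of games -/

section Accel

variable {P : Type u} (M : P → Set (Col C × P) → Set (Col C × P) → Prop)

/-- The game where no distinction is made between both kinds of moves. -/
def flat (p : P) (V : Set (Col C × P)) : Prop := M p V V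

/-- The game which ends with the first move of the second kind. The pair of the
maximal colour which occurred and of the last position has then to be in `W`. -/
def inner (W : Set (Col C × P)) (x : Col C × P) (V : Set (Col C × (Col C × P))) : Prop :=
  M x.2 {m | (m.1, (max x.1 m.1, m.2)) ∈ V} {m | (max x.1 m.1, m.2) ∈ W}

/-- The game where a play up to the first move of the second kind is a single move. -/
def accel (p : P) (W : Set (Col C × P)) : Prop := Win (inner M W) (⊥, p)

/-- The player may enlarge the sets chosen. -/
def MoveMono₂ : Prop :=
  ∀ ⦃p V V' W W'⦄, V ⊆ V' → W ⊆ W' → M p V W → M p V' W'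

variable {M}

theorem MoveMono₂.flat (hM : MoveMono₂ M) : MoveMono (flat M) := fun _ _ _ h => hM h h

theorem MoveMono₂.inner (hM : MoveMono₂ M) (W : Set (Col C × P)) : MoveMono (inner M W) :=
  fun _ _ _ h => hM (fun _ hm => h hm) subset_rfl

/-- There is a path of `n + 1` edges from `q` to `q'`, and `c` is the maximum of `acc` and of
the colours on this path. -/
def Reach {Q : Type u} (E : Q → Col C → Q → Prop) : ℕ → Col C → Q → Col C → Q → Prop
  | 0, acc, q, c, q' => ∃ d, E q d q' ∧ max acc d = c
  | n + 1, acc, q, c, q' => ∃ d q₁, E q d q₁ ∧ Reach E n (max acc d) q₁ c q'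

/-- Finite paths laid end to end form an infinite path of `E`, and their colours are the maxima of
its blocks, so `parity_blocks` applies. -/
theorem Sound.reach {Q : Type u} {E : Q → Col C → Q → Prop} (hE : Sound E) :
    Sound fun q c q' => ∃ n, Reach E n ⊥ q c q' := by
  classical
  intro q c h
  choose len hlen using h
  -- A tuple `(k, n, acc, r)` is a point of the concatenation: `r` lies on the `k`-th path, `n + 1`
  -- edges of it remain, and `acc` is the maximum of the colours already seen on it.
  let T := {x : ℕ × ℕ × Col C × Q // Reach E x.2.1 x.2.2.1 x.2.2.2 (c x.1) (q (x.1 + 1))}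
  have step : ∀ x : T, ∃ (d : Col C) (y : T), E x.1.2.2.2 d y.1.2.2.2 ∧
      (x.1.2.1 = 0 → y.1.1 = x.1.1 + 1 ∧ y.1.2.2.1 = ⊥ ∧ max x.1.2.2.1 d = c x.1.1) ∧
      (x.1.2.1 ≠ 0 → y.1.1 = x.1.1 ∧ y.1.2.2.1 = max x.1.2.2.1 d ∧
        x.1.2.1 = y.1.2.1 + 1) := by
    rintro ⟨⟨k, n, acc, r⟩, hr⟩
    cases n with
    | zero =>
      obtain ⟨d, hd, hc⟩ := hr
      exact ⟨d, ⟨⟨k + 1, len (k + 1), ⊥, q (k + 1)⟩, hlen (k + 1)⟩, hd,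
        fun _ => ⟨rfl, rfl, hc⟩, fun h => (h rfl).elim⟩
    | succ n =>
      obtain ⟨d, r', hd, hr'⟩ := hr
      exact ⟨d, ⟨⟨k, n, max acc d, r'⟩, hr'⟩, hd, fun h => (Nat.succ_ne_zero n h).elim,
        fun _ => ⟨rfl, rfl, rfl⟩⟩
  choose col next hnext hcut hgo using step
  let x : ℕ → T := fun n => Nat.rec ⟨⟨0, len 0, ⊥, q 0⟩, hlen 0⟩ (fun _ y => next y) n
  let cut : ℕ → Prop := fun j => (x j).1.2.1 = 0
  have hinf : {n | cut n}.Infinite := by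
    -- Without further cuts the remaining length would decrease forever.
    rw [← Nat.frequently_atTop_iff_infinite, Filter.frequently_atTop]
    intro N
    by_contra hN
    push Not at hN
    have : ∀ k, (x (N + k)).1.2.1 + k = (x N).1.2.1 := by
      intro k
      induction k with
      | zero => rfl
      | succ k ih =>
        have h : (x (N + k)).1.2.1 = (x (N + (k + 1))).1.2.1 + 1 :=
          (hgo (x (N + k)) (hN (N + k) (by omega))).2.2
        omega
    have := this ((x N).1.2.1 + 1)
    omega
  -- The index of the current path is the number of earlier cuts, so the `k`-th cut ends the `k`-th
  -- path.
  have hcount : ∀ j, (x j).1.1 = Nat.count cut j := by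
    intro j
    induction j with
    | zero => rfl
    | succ j ih =>
      rw [Nat.count_succ, ← ih]
      by_cases hj : cut j
      · rw [if_pos hj]
        exact (hcut (x j) hj).1
      · rw [if_neg hj]
        exact (hgo (x j) hj).1
  have hpar := hE (fun j => (x j).1.2.2.2) (fun j => col (x j)) fun j => hnext (x j)
  rw [← parity_blocks (acc := fun j => (x j).1.2.2.1) hinf (fun j hj => (hcut (x j) hj).2.1)
    (fun j hj => (hgo (x j) hj).2.1)] at hpar
  convert hpar using 2 with k
  have hs : cut (Nat.nth cut k) := Nat.nth_mem_of_infinite hinf k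
  rw [(hcut _ hs).2.2, hcount, Nat.count_nth_of_infinite hinf]

/-- An edge of the accelerated strategy is any nonempty path of the given one, coloured by its
maximum. Paths which continue through moves of the second kind are also admitted: soundness covers
all of them, and moves may be enlarged. -/
theorem Win.accel (hM : MoveMono₂ M) {p : P} (h : Win (flat M) p) : Win (accel M) p := by
  obtain ⟨σ, q₀, rfl⟩ := h
  refine ⟨⟨σ.State, σ.pos, fun q c q' => ∃ n, Reach σ.edge n ⊥ q c q', fun q => ?_,
    σ.sound.reach⟩, q₀, rfl⟩
  -- The invariant of the inner game: whatever is reached from here, with the accumulated colour, is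
  -- reached from `q` starting with `⊥`.
  let T := {x : Col C × σ.State // ∀ n e q', Reach σ.edge n x.1 x.2 e q' →
    ∃ n, Reach σ.edge n ⊥ q e q'}
  refine ⟨⟨T, fun x => (x.1.1, σ.pos x.1.2),
    fun x d y => σ.edge x.1.2 d y.1.2 ∧ y.1.1 = max x.1.1 d, fun x => ?_, fun x c hx =>
      σ.sound (fun n => (x n).1.2) c fun n => (hx n).1⟩, ⟨(⊥, q), fun n e q' h => ⟨n, h⟩⟩, rfl⟩
  refine hM ?_ ?_ (σ.legal x.1.2)
  · rintro ⟨d, _⟩ ⟨q', hq', rfl⟩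
    exact ⟨⟨(max x.1.1 d, q'), fun n e q'' h => x.2 (n + 1) e q'' ⟨d, q', hq', h⟩⟩,
      ⟨hq', rfl⟩, rfl⟩
  · rintro ⟨d, _⟩ ⟨q', hq', rfl⟩
    exact ⟨q', x.2 0 _ q' ⟨d, hq', rfl⟩, rfl⟩

/-- Each move of the accelerated strategy `σ` is itself witnessed by a strategy `τ q` of the inner
game. The combined strategy plays `τ q` until a move of the second kind, then takes an edge of `σ`
and restarts with the inner strategy of the new state. -/
theorem Win.of_accel (hM : MoveMono₂ M) {p : P} (h : Win (FinScottL.accel M) p) :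
    Win (flat M) p := by
  classical
  obtain ⟨σ, q₀, rfl⟩ := h
  choose τ r hr using σ.legal
  let cutEdge : (Σ q, (τ q).State) → Col C → (Σ q, (τ q).State) → Prop := fun x d y =>
    σ.edge x.1 (max ((τ x.1).pos x.2).1 d) y.1 ∧ y.2 = r y.1
  let goEdge : (Σ q, (τ q).State) → Col C → (Σ q, (τ q).State) → Prop := fun x d y =>
    SigmaEdge (fun q => (τ q).edge) x d y ∧
      ((τ y.1).pos y.2).1 = max ((τ x.1).pos x.2).1 d
  refine ⟨⟨Σ q, (τ q).State, fun x => ((τ x.1).pos x.2).2,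
    fun x d y => cutEdge x d y ∨ goEdge x d y, ?_, ?_⟩, ⟨q₀, r q₀⟩, congrArg Prod.snd (hr q₀)⟩
  · rintro ⟨q, x⟩
    refine hM ?_ ?_ ((τ q).legal x)
    · rintro ⟨d, p'⟩ ⟨x', hx', h⟩
      exact ⟨⟨q, x'⟩, Or.inr ⟨⟨hx'⟩, congrArg Prod.fst h⟩,
        show ((τ q).pos x').2 = p' by rw [h]⟩
    · rintro ⟨d, _⟩ ⟨q', hq', rfl⟩
      exact ⟨⟨q', r q'⟩, Or.inl ⟨hq', rfl⟩, by rw [hr]⟩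
  · intro x d hx
    let cut : ℕ → Prop := fun n => cutEdge (x n) (d n) (x (n + 1))
    have hgo : ∀ n, ¬ cut n → goEdge (x n) (d n) (x (n + 1)) := fun n hn =>
      (hx n).resolve_left hn
    -- With infinitely many cuts, the maxima of the blocks are the colours of a path of `σ`.
    -- Otherwise the play ends up inside a single inner strategy.
    by_cases hinf : {n | cut n}.Infinite
    · rw [← parity_blocks (acc := fun n => ((τ (x n).1).pos (x n).2).1) hinf
        (fun n hn => by rw [hn.2, hr]) (fun n hn => (hgo n hn).2)]
      refine σ.sound (fun k => (x (Nat.nth cut k)).1) _ fun k => ?_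
      have hs : cut (Nat.nth cut k) := Nat.nth_mem_of_infinite hinf k
      have hlt : Nat.nth cut k < Nat.nth cut (k + 1) := Nat.nth_strictMono hinf k.lt_succ_self
      -- Between consecutive cuts the state of `σ` does not change.
      have const : ∀ m, Nat.nth cut k + 1 ≤ m → m ≤ Nat.nth cut (k + 1) →
          (x m).1 = (x (Nat.nth cut k + 1)).1 := by
        intro m hm
        induction m, hm using Nat.le_induction with
        | base => exact fun _ => rfl
        | succ m hm ih =>
          intro hm'
          rw [← ih (by omega)]
          have hns : ¬ cut m := by
            intro hsm
            have h₁ : Nat.nth cut k < m := hm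
            have h₂ : m < Nat.nth cut (k + 1) := hm'
            -- The rank of such a cut would lie strictly between `k` and `k + 1`.
            rw [← Nat.nth_count hsm] at h₁ h₂
            have := (Nat.nth_strictMono hinf).lt_iff_lt.1 h₁
            have := (Nat.nth_strictMono hinf).lt_iff_lt.1 h₂
            omega
          have := (hgo m hns).1
          revert this
          generalize x m = y
          generalize x (m + 1) = z
          rintro ⟨-⟩
          rfl
      have h := hs.1
      rw [← const _ hlt le_rfl] at h
      exact h
    · obtain ⟨N, hN⟩ := (Set.not_infinite.1 hinf).bddAbove
      refine (parity_shift (N + 1)).1 (Sound.sigma (fun q => (τ q).sound)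
        (fun n => x (n + (N + 1))) _ fun n => ?_)
      have := (hgo (n + (N + 1)) fun h => by have := hN h; omega).1
      rwa [show n + (N + 1) + 1 = n + 1 + (N + 1) by omega] at this

theorem win_accel_iff (hM : MoveMono₂ M) {p : P} : Win (FinScottL.accel M) p ↔ Win (flat M) p :=
  ⟨Win.of_accel hM, Win.accel hM⟩

end Accel

end Game

end FinScottL

namespace FinScottL

/-! ### The fixpoint operator as a parity game -/

/-! ### Unpainting: the action of colours on parameters. -/

section Unpaint

variable {C : Finset ℕ} {α : Type u} [Preorder α] [Finite α]

theorem Bang.mem_unpaint {c : Col C} {s : Bang (Box C α)} {z : Box C α} :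
    z ∈ Bang.unpaint c s ↔ ∃ x ∈ s, x.col = max c z.col ∧ z.val ≤ x.val := Bang.mem_ofSet _ _

/-- Successive unpaintings compose by `max`; hence the parameter at a position depends only on the
maximal colour of the play so far. -/
theorem Bang.unpaint_unpaint (c d : Col C) (s : Bang (Box C α)) :
    Bang.unpaint d (Bang.unpaint c s) = Bang.unpaint (max c d) s := by
  refine Bang.ext fun z => ?_
  simp only [Bang.mem_unpaint]
  constructor
  · rintro ⟨x, ⟨y, hy, hyx, hxy⟩, hxz, hzx⟩
    exact ⟨y, hy, by rw [hyx, hxz, max_assoc], hzx.trans hxy⟩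
  · rintro ⟨y, hy, hyz, hzy⟩
    exact ⟨⟨max d z.col, z.val⟩, ⟨y, hy, by rw [hyz, max_assoc], hzy⟩, rfl, le_rfl⟩

theorem Bang.unpaint_mono (c : Col C) {s t : Bang (Box C α)} (h : s ≤ t) :
    Bang.unpaint c s ≤ Bang.unpaint c t := fun _ hz =>
  ⟨_, ((Bang.unpaint_paint c s).mono le_rfl h).mem hz, le_rfl⟩

/-- `Bang.unpaint ⊥ s` is the downward closure of `s`, equivalent to `s` in the preorder but in
general a different set. Several arguments below therefore hold only up to `≤`. -/
theorem Bang.unpaint_bot_le (s : Bang (Box C α)) : Bang.unpaint ⊥ s ≤ s :=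
  Bang.paint_bot.1 (Bang.unpaint_paint _ _)

theorem Bang.le_unpaint_bot (s : Bang (Box C α)) : s ≤ Bang.unpaint ⊥ s := fun z hz =>
  ⟨z, (Bang.paint_bot.2 le_rfl : Bang.Paint ⊥ s s).mem hz, le_rfl⟩

end Unpaint

variable {C : Finset ℕ} {X A : FinScottL.{u}}

/-- The game of `R`: at the position `(s, b)`, the player chooses `v` such that `R` relates
`(s, v)` to `b`, and the opponent chooses an element of `v`. -/
def runGame (R : colObj C X ⊗ colObj C A ⟶ A) (p : Bang (Box C X) × A)
    (V : Set (Col C × (Bang (Box C X) × A))) : Prop :=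
  ∃ v : Bang (Box C A), R.rel (p.1, v) p.2 ∧
    ∀ y ∈ v, (y.col, (Bang.unpaint y.col p.1, y.val)) ∈ V

theorem runGame_mono (R : colObj C X ⊗ colObj C A ⟶ A) : MoveMono (runGame R) :=
  fun _ _ _ h ⟨v, hv, hV⟩ => ⟨v, hv, fun y hy => h (hV y hy)⟩

theorem Win.runGame_le {R : colObj C X ⊗ colObj C A ⟶ A} {s s' : Bang (Box C X)} {a a' : A}
    (h : Win (runGame R) (s, a)) (hs : s ≤ s') (ha : a' ≤ a) : Win (runGame R) (s', a') := by
  refine Win.simulate (fun p p' => p.1 ≤ p'.1 ∧ p'.2 ≤ p.2) ?_ h ⟨hs, ha⟩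
  rintro p p' V ⟨h₁, h₂⟩ ⟨v, hv, hV⟩
  exact ⟨v, down R hv ⟨h₁, le_rfl⟩ h₂, fun y hy => ⟨_, hV y hy, Bang.unpaint_mono _ h₁, le_rfl⟩⟩

/-! ### From run-trees to strategies. -/

namespace ColTree

variable (t : ColTree C (X ⊕ A))

/-- The states are the nodes labelled in `A`, and a node remembers `s` unpainted by the maximal
colour of its path. Children in `X` are allowed there because their path colours put them into the
set of leaves `s`. -/
theorem win_of_isRunTree {R : colObj C X ⊗ colObj C A ⟶ A} {s : Bang (Box C X)} {a : A}
    (ht : t.IsRunTree R a) (hw : t.Winning) (hl : t.leaves = {y | y ∈ s}) :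
    Win (runGame R) (s, a) := by
  let Q := {x : List ℕ × A // t.IsNode x.1 ∧ t.label x.1 = Sum.inr x.2}
  let pos : Q → Bang (Box C X) × A := fun x => (Bang.unpaint (t.pathCol x.1.1) s, x.1.2)
  let E : Q → Col C → Q → Prop := fun x c y => ∃ i, y.1.1 = i :: x.1.1 ∧ t.col y.1.1 = c
  have key : Win (runGame R) (pos ⟨([], a), trivial, ht.root_label⟩) := by
    refine Win.of_root pos E _ ?_ ?_
    · rintro ⟨⟨p, b⟩, hp, hb⟩
      refine ⟨t.childrenA p, down R (ht.step p b hp hb) ⟨?_, le_rfl⟩ le_rfl, ?_⟩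
      · intro y hy
        obtain ⟨i, hi, hc, hy'⟩ := (Bang.mem_ofSet _ y).1 hy
        refine ⟨y, Bang.mem_unpaint.2 ⟨⟨max (t.pathCol p) y.col, y.val⟩, ?_, rfl, le_rfl⟩, le_rfl⟩
        have : (⟨max (t.pathCol p) y.col, y.val⟩ : Box C X) ∈ t.leaves :=
          ⟨i :: p, ⟨hp, hi⟩, hy', by rw [pathCol, hc, max_comm]⟩
        rwa [hl] at this
      · intro y hy
        obtain ⟨i, hi, hc, hy'⟩ := (Bang.mem_ofSet _ y).1 hy
        refine ⟨⟨(i :: p, y.val), ⟨hp, hi⟩, hy'⟩, ⟨i, rfl, hc⟩, Prod.ext ?_ rfl⟩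
        change Bang.unpaint (t.pathCol (i :: p)) s = Bang.unpaint y.col (Bang.unpaint _ s)
        rw [Bang.unpaint_unpaint, pathCol, hc, max_comm]
    · intro q c h0 hE
      -- The child indices along the play define a branch of the tree. The colour of an edge is that
      -- of its target, hence the shift by one.
      choose i hi hc using hE
      have hpos : ∀ n, ColTree.pos i n = (q n).1.1 := by
        intro n
        induction n with
        | zero => rw [h0]; rfl
        | succ n ih => rw [hi n, ← ih]; rfl
      have hpar : Parity fun n => t.col (ColTree.pos i n) := hw i fun n => hpos n ▸ (q n).2.1
      rw [← parity_shift 1] at hpar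
      convert hpar using 2 with n
      rw [hpos, hc]
  -- The root remembers `Bang.unpaint ⊥ s` rather than `s`.
  refine key.runGame_le ?_ le_rfl
  rw [show t.pathCol [] = ⊥ from ht.root_col]
  exact Bang.unpaint_bot_le s

/-! ### From strategies to run-trees. -/

section Unfold

variable {N L : Type u} (ch : N → List N) (n₀ : N)

/-- The node at some address of the unfolding of a graph. -/
def content : List ℕ → N
  | [] => n₀
  -- The default value is only used at addresses which are not nodes of the unfolding.
  | i :: p => (ch (content p))[i]?.getD (content p)

/-- The unfolding of a graph from the node `n₀`, where `ch` gives the children of a node. -/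
def unfolding (label : N → L) (col : N → Col C) : ColTree C L where
  arity p := (ch (content ch n₀ p)).length
  label p := label (content ch n₀ p)
  col p := col (content ch n₀ p)

theorem content_mem {p : List ℕ} {i : ℕ} (h : i < (ch (content ch n₀ p)).length) :
    content ch n₀ (i :: p) ∈ ch (content ch n₀ p) := by
  rw [content, List.getElem?_eq_getElem h]
  exact List.getElem_mem h

theorem exists_content {p : List ℕ} {n : N} (h : n ∈ ch (content ch n₀ p)) :
    ∃ i < (ch (content ch n₀ p)).length, content ch n₀ (i :: p) = n := by
  obtain ⟨i, hi, rfl⟩ := List.mem_iff_getElem.1 h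
  exact ⟨i, hi, by rw [content, List.getElem?_eq_getElem hi]; rfl⟩

end Unfold

end ColTree

/-- The strategy is unfolded. Below a state at position `(s', b)` hang all elements of `s'` as
leaves, and one successor for each element of the chosen finite set. The leaves obtained are only
below `s`, and the closure of `fixOp` under `≤` does the rest. -/
theorem fixRel_of_win {R : colObj C X ⊗ colObj C A ⟶ A} {s : Bang (Box C X)} {a : A}
    (h : Win (runGame R) (s, a)) : (fixOp C X A R).rel s a := by
  classical
  obtain ⟨σ, q₀, hq₀⟩ := h
  choose v hv hnext using σ.legal
  -- Choosing one answer for each element of `v q` makes the tree finitely branching, whatever the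
  -- number of edges of `σ`. The value for `y` outside `v q` is arbitrary.
  have hnext' : ∀ q y, ∃ q', y ∈ v q → σ.edge q y.col q' ∧
      σ.pos q' = (Bang.unpaint y.col (σ.pos q).1, y.val) := fun q y => by
    by_cases hy : y ∈ v q
    · obtain ⟨q', h⟩ := hnext q y hy
      exact ⟨q', fun _ => h⟩
    · exact ⟨q, fun h => (hy h).elim⟩
  choose next hedge hpos using hnext'
  let ch : Box C X ⊕ Box C σ.State → List (Box C X ⊕ Box C σ.State) := Sum.elim (fun _ => [])
    fun q => (σ.pos q.val).1.elems.toList.map Sum.inl ++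
      (v q.val).elems.toList.map fun y => Sum.inr ⟨y.col, next q.val y⟩
  let n₀ : Box C X ⊕ Box C σ.State := Sum.inr ⟨⊥, q₀⟩
  let t : ColTree C (X ⊕ A) := ColTree.unfolding ch n₀
    (Sum.map Box.val fun q => (σ.pos q.val).2) (Sum.elim Box.col Box.col)
  have inl_mem : ∀ {y q}, Sum.inl y ∈ ch (Sum.inr q) ↔ y ∈ (σ.pos q.val).1 := fun {y q} => by
    simp [ch]
    rfl
  have inr_mem : ∀ {r q}, Sum.inr r ∈ ch (Sum.inr q) ↔
      ∃ y ∈ v q.val, (⟨y.col, next q.val y⟩ : Box C σ.State) = r := fun {r q} => by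
    simp [ch]
    rfl
  have content_inr : ∀ p b, t.label p = Sum.inr b →
      ∃ q, ColTree.content ch n₀ p = Sum.inr q ∧ (σ.pos q.val).2 = b := fun p b hb => by
    change Sum.map _ _ (ColTree.content ch n₀ p) = _ at hb
    rcases h : ColTree.content ch n₀ p with y | q
    · rw [h] at hb; cases hb
    · rw [h] at hb; exact ⟨q, rfl, Sum.inr.inj hb⟩
  have inner : ∀ p, 0 < t.arity p → ∃ q, ColTree.content ch n₀ p = Sum.inr q := fun p hp => by
    change 0 < (ch (ColTree.content ch n₀ p)).length at hp
    rcases h : ColTree.content ch n₀ p with y | q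
    · rw [h] at hp; exact (lt_irrefl 0 hp).elim
    · exact ⟨q, rfl⟩
  have hrun : t.IsRunTree R a := by
    refine ⟨?_, rfl, ?_, ?_⟩
    · change Sum.inr (σ.pos q₀).2 = _
      rw [hq₀]
    · intro p _ h0
      obtain ⟨q, hq⟩ := inner p h0
      refine ⟨(σ.pos q.val).2, ?_⟩
      change Sum.map _ _ (ColTree.content ch n₀ p) = _
      rw [hq]; rfl
    · intro p b _ hb
      obtain ⟨q, hq, rfl⟩ := content_inr p b hb
      refine down R (hv q.val) ⟨fun y hy => ⟨y, (Bang.mem_ofSet _ _).2 ?_, le_rfl⟩,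
        fun y hy => ⟨y, (Bang.mem_ofSet _ _).2 ?_, le_rfl⟩⟩ le_rfl
      · obtain ⟨i, hi, h⟩ := ColTree.exists_content ch n₀ (p := p) (hq ▸ inl_mem.2 hy)
        refine ⟨i, hi, ?_, ?_⟩
        · change Sum.elim _ _ (ColTree.content ch n₀ (i :: p)) = _
          rw [h]; rfl
        · change Sum.map _ _ (ColTree.content ch n₀ (i :: p)) = _
          rw [h]; rfl
      · obtain ⟨i, hi, h⟩ := ColTree.exists_content ch n₀ (p := p) (hq ▸ inr_mem.2 ⟨y, hy, rfl⟩)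
        refine ⟨i, hi, ?_, ?_⟩
        · change Sum.elim _ _ (ColTree.content ch n₀ (i :: p)) = _
          rw [h]; rfl
        · change Sum.map _ _ (ColTree.content ch n₀ (i :: p)) = _
          rw [h]
          change Sum.inr (σ.pos (next q.val y)).2 = _
          rw [hpos _ _ hy]
  have hwin : t.Winning := by
    intro i hi
    change Parity fun n => t.col (ColTree.pos i n)
    -- Each node of an infinite branch has a child, so it is a state and not a leaf in `X`.
    choose q hq using fun n => inner (ColTree.pos i n) (Nat.zero_lt_of_lt (hi (n + 1)).2)
    rw [← parity_shift 1]
    have hstep : ∀ n, ∃ y ∈ v (q n).val, (⟨y.col, next (q n).val y⟩ : Box C σ.State) = q (n + 1) :=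
      fun n => by
        have := ColTree.content_mem ch n₀ (hi (n + 1)).2
        rw [hq n] at this
        exact inr_mem.1 ((hq (n + 1)) ▸ this)
    refine σ.sound (fun n => (q n).val) _ fun n => ?_
    obtain ⟨y, hy, hy'⟩ := hstep n
    have hcol : t.col (ColTree.pos i (n + 1)) = (q (n + 1)).col := by
      change Sum.elim _ _ (ColTree.content ch n₀ _) = _
      rw [hq (n + 1)]; rfl
    rw [hcol, ← hy']
    exact hedge _ _ hy
  -- Each parameter met in the tree lies below `s` unpainted by the colour of the path; for leaves
  -- this bounds them by elements of `s` of the same path colour.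
  have hinv : ∀ p, t.IsNode p →
      (∀ q, ColTree.content ch n₀ p = Sum.inr q →
        (σ.pos q.val).1 ≤ Bang.unpaint (t.pathCol p) s) ∧
      (∀ y, ColTree.content ch n₀ p = Sum.inl y →
        ∃ x ∈ s, x.col = t.pathCol p ∧ y.val ≤ x.val) := by
    intro p
    induction p with
    | nil =>
      intro _
      refine ⟨fun q hq => ?_, fun y hy => by cases hy⟩
      obtain rfl := Sum.inr.inj hq
      change (σ.pos q₀).1 ≤ Bang.unpaint ⊥ s
      rw [hq₀]
      exact Bang.le_unpaint_bot s
    | cons i p ih =>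
      rintro ⟨hp, hi⟩
      obtain ⟨q, hq⟩ := inner p (Nat.zero_lt_of_lt hi)
      have hle := (ih hp).1 q hq
      have hmem := ColTree.content_mem ch n₀ hi
      rw [hq] at hmem
      constructor
      · intro q' hq'
        rw [hq'] at hmem
        obtain ⟨y, hy, rfl⟩ := inr_mem.1 hmem
        have hcol : t.col (i :: p) = y.col := by
          change Sum.elim _ _ (ColTree.content ch n₀ _) = _
          rw [hq']; rfl
        rw [hpos _ _ hy, ColTree.pathCol, hcol, max_comm, ← Bang.unpaint_unpaint]
        exact Bang.unpaint_mono _ hle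
      · intro y hy
        rw [hy] at hmem
        have hcol : t.col (i :: p) = y.col := by
          change Sum.elim _ _ (ColTree.content ch n₀ _) = _
          rw [hy]; rfl
        obtain ⟨z, hz, hyz, hyz'⟩ := hle y (inl_mem.1 hmem)
        obtain ⟨x, hx, hxz, hzx⟩ := Bang.mem_unpaint.1 hz
        exact ⟨x, hx, by rw [hxz, ← hyz, ColTree.pathCol, hcol, max_comm], hyz'.trans hzx⟩
  have hleaves : (fixOp C X A R).rel (Bang.ofSet t.leaves) a :=
    ⟨t, hrun, hwin, by ext y; exact (Bang.mem_ofSet _ y).symm⟩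
  refine down _ hleaves (fun y hy => ?_) le_rfl
  obtain ⟨p, hp, hlab, hcol⟩ := (Bang.mem_ofSet _ y).1 hy
  change Sum.map _ _ (ColTree.content ch n₀ p) = _ at hlab
  rcases h : ColTree.content ch n₀ p with z | q
  · rw [h] at hlab
    obtain ⟨x, hx, hxc, hzx⟩ := (hinv p hp).2 z h
    have e : z.val = y.val := Sum.inl.inj hlab
    exact ⟨x, hx, by rw [hxc, hcol], e ▸ hzx⟩
  · rw [h] at hlab; cases hlab

/-- The fixpoint operator computes the winning positions of a parity game. -/
theorem fixOp_rel_iff (R : colObj C X ⊗ colObj C A ⟶ A) (s : Bang (Box C X)) (a : A) :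
    (fixOp C X A R).rel s a ↔ Win (runGame R) (s, a) :=
  ⟨fun ⟨t, ht, hw, hl⟩ => t.win_of_isRunTree ht hw hl, fixRel_of_win⟩

end FinScottL

namespace FinScottL

/-! ### The relations of the structural morphisms -/

section Rel

variable {C : Finset ℕ} {X A B D : FinScottL.{u}}

/-- The largest `t` such that `prom g` relates `s` to `t`. -/
noncomputable def promVal (g : colObj C X ⟶ A) (s : Bang (Box C X)) : Bang (Box C A) :=
  Bang.ofSet {y | g.rel (Bang.unpaint y.col s) y.val}

theorem mem_promVal {g : colObj C X ⟶ A} {s : Bang (Box C X)} {y : Box C A} :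
    y ∈ promVal g s ↔ g.rel (Bang.unpaint y.col s) y.val := Bang.mem_ofSet _ _

theorem prom_rel_promVal (g : colObj C X ⟶ A) (s : Bang (Box C X)) :
    (prom g).rel s (promVal g s) := (prom_rel _ _ _).2 fun _ hy => mem_promVal.1 hy

theorem le_promVal {g : colObj C X ⟶ A} {s : Bang (Box C X)} {t : Bang (Box C A)}
    (h : (prom g).rel s t) : t ≤ promVal g s := fun y hy =>
  ⟨y, mem_promVal.2 ((prom_rel _ _ _).1 h y hy), le_rfl⟩

/-- Both sides consist of the values of `g` at `s` unpainted by `max c` of the colour of the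
element. -/
theorem unpaint_promVal (g : colObj C X ⟶ A) (c : Col C) (s : Bang (Box C X)) :
    Bang.unpaint c (promVal g s) = promVal g (Bang.unpaint c s) := by
  refine Bang.ext fun z => ?_
  rw [Bang.mem_unpaint, mem_promVal, Bang.unpaint_unpaint]
  constructor
  · rintro ⟨x, hx, hc, hzx⟩
    exact down g (hc ▸ mem_promVal.1 hx) le_rfl hzx
  · intro h
    exact ⟨⟨max c z.col, z.val⟩, mem_promVal.2 h, rfl, le_rfl⟩

/-- Relations are upward closed in their source, so the intermediate value may be taken to be the
largest one. In this way promotions behave like functions. -/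
theorem prom_comp_rel (g : colObj C X ⟶ A) (R : colObj C A ⟶ D) (s : Bang (Box C X)) (d : D) :
    Hom.rel (prom g ≫ R) s d ↔ R.rel (promVal g s) d :=
  ⟨fun ⟨_, h, h'⟩ => down R h' (le_promVal h) le_rfl, fun h => ⟨_, prom_rel_promVal g s, h⟩⟩

theorem prom_whiskerRight_comp_rel (g : colObj C X ⟶ A) (R : colObj C A ⊗ B ⟶ D)
    (s : Bang (Box C X)) (b : B) (d : D) :
    Hom.rel (prom g ▷ B ≫ R) (s, b) d ↔ R.rel (promVal g s, b) d :=
  ⟨fun ⟨_, h, h'⟩ => down R h' ⟨le_promVal h.1, h.2⟩ le_rfl,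
    fun h => ⟨(promVal g s, b), ⟨prom_rel_promVal g s, le_rfl⟩, h⟩⟩

theorem whiskerLeft_prom_comp_rel (g : colObj C X ⟶ A) (R : B ⊗ colObj C A ⟶ D)
    (b : B) (s : Bang (Box C X)) (d : D) :
    Hom.rel (B ◁ prom g ≫ R) (b, s) d ↔ R.rel (b, promVal g s) d :=
  ⟨fun ⟨_, h, h'⟩ => down R h' ⟨h.1, le_promVal h.2⟩ le_rfl,
    fun h => ⟨(b, promVal g s), ⟨le_rfl, prom_rel_promVal g s⟩, h⟩⟩

theorem seely_inv_comp_rel (R : colObj C A ⊗ colObj C B ⟶ D) (s : Bang (Box C (A ⊕ B))) (d : D) :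
    Hom.rel ((seely A B).inv ≫ R) s d ↔ R.rel (s.left, s.right) d :=
  ofMap_comp_rel (A := colObj C (withObj A B)) (B := tensor (colObj C A) (colObj C B)) _ R s d

theorem con_rel {s : Bang (Box C A)} {p : Bang (Box C A) × Bang (Box C A)} :
    (con A).rel s p ↔ p.1 ≤ s ∧ p.2 ≤ s := by
  constructor
  · rintro ⟨t, h, h'⟩
    have h₁ : p.1 ≤ t.left := h'.1
    have h₂ : p.2 ≤ t.right := h'.2
    refine ⟨h₁.trans fun y hy => ?_, h₂.trans fun y hy => ?_⟩
    · obtain ⟨x, hx, hc, hxy⟩ := h _ (Bang.mem_left.1 hy)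
      exact ⟨x, hx, hc.symm, hxy⟩
    · obtain ⟨x, hx, hc, hxy⟩ := h _ (Bang.mem_right.1 hy)
      exact ⟨x, hx, hc.symm, hxy⟩
  · rintro ⟨h₁, h₂⟩
    refine ⟨Bang.merge p.1 p.2, ?_, ?_⟩
    · rintro ⟨c, a | a⟩ hy
      · obtain ⟨x, hx, hc, hax⟩ := h₁ _ (Bang.inl_mem_merge.1 hy)
        exact ⟨x, hx, hc.symm, hax⟩
      · obtain ⟨x, hx, hc, hax⟩ := h₂ _ (Bang.inr_mem_merge.1 hy)
        exact ⟨x, hx, hc.symm, hax⟩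
    · exact ((mergeIso A A).symm_apply_apply p).ge

theorem con_comp_rel (R : colObj C A ⊗ colObj C A ⟶ D) (s : Bang (Box C A)) (d : D) :
    Hom.rel (con A ≫ R) s d ↔ R.rel (s, s) d :=
  ⟨fun ⟨_, h, h'⟩ => down R h' (con_rel.1 h) le_rfl,
    fun h => ⟨(s, s), con_rel.2 ⟨le_rfl, le_rfl⟩, h⟩⟩

theorem unpaint_merge {α β : Type u} [Preorder α] [Preorder β] [Finite α] [Finite β]
    (c : Col C) (s : Bang (Box C α)) (t : Bang (Box C β)) :
    Bang.unpaint c (Bang.merge s t) = Bang.merge (Bang.unpaint c s) (Bang.unpaint c t) := by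
  refine Bang.ext ?_
  rintro ⟨d, a | b⟩
  · rw [Bang.mem_unpaint, Bang.inl_mem_merge, Bang.mem_unpaint]
    constructor
    · rintro ⟨⟨e, a' | b'⟩, hx, hc, hzx⟩
      · exact ⟨⟨e, a'⟩, Bang.inl_mem_merge.1 hx, hc, Sum.inl_le_inl_iff.1 hzx⟩
      · exact (Sum.not_inl_le_inr hzx).elim
    · rintro ⟨⟨e, a'⟩, hx, hc, hzx⟩
      exact ⟨⟨e, Sum.inl a'⟩, Bang.inl_mem_merge.2 hx, hc, Sum.inl_le_inl_iff.2 hzx⟩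
  · rw [← Bang.mem_right, unpaint_merge_right, Bang.inr_mem_merge]

theorem left_merge {α β : Type u} [Finite α] [Finite β]
    (s : Bang (Box C α)) (t : Bang (Box C β)) : (Bang.merge s t).left = s :=
  Bang.ext fun ⟨_, _⟩ => Bang.mem_left.trans Bang.inl_mem_merge

theorem right_merge {α β : Type u} [Finite α] [Finite β]
    (s : Bang (Box C α)) (t : Bang (Box C β)) : (Bang.merge s t).right = t :=
  Bang.ext fun ⟨_, _⟩ => Bang.mem_right.trans Bang.inr_mem_merge

theorem prom₂_rel (g : colObj C X ⊗ colObj C A ⟶ B) (s : Bang (Box C X)) (v : Bang (Box C A))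
    (w : Bang (Box C B)) : (prom₂ g).rel (s, v) w ↔
      ∀ y ∈ w, g.rel (Bang.unpaint y.col s, Bang.unpaint y.col v) y.val := by
  refine (seely_hom_comp_rel _ (s, v) w).trans ((prom_rel _ _ _).trans
    (forall₂_congr fun y _ => (seely_inv_comp_rel g _ _).trans ?_))
  have e : (Bang.unpaint y.col (Bang.merge s v)) =
    Bang.merge (Bang.unpaint y.col s) (Bang.unpaint y.col v) := unpaint_merge _ _ _
  have e' : ((Bang.unpaint y.col (Bang.merge s v)).left,
      (Bang.unpaint y.col (Bang.merge s v)).right) =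
      (Bang.unpaint y.col s, Bang.unpaint y.col v) := by
    rw [e, left_merge, right_merge]
  exact iff_of_eq (congrArg (fun p => g.rel p y.val) e')

theorem star_rel (f : colObj C X ⊗ colObj C B ⟶ A) (g : colObj C X ⊗ colObj C A ⟶ B)
    (s : Bang (Box C X)) (v : Bang (Box C A)) (a : A) : (star f g).rel (s, v) a ↔
      ∃ w : Bang (Box C B), f.rel (s, w) a ∧
        ∀ y ∈ w, g.rel (Bang.unpaint y.col s, Bang.unpaint y.col v) y.val := by
  constructor
  · rintro ⟨p, h₁, q, h₂, ⟨s', w⟩, h₃, h₄⟩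
    obtain ⟨⟨s₁, s₂⟩, v₁⟩ := p
    obtain ⟨s₃, s₄, v₂⟩ := q
    have hs : s₁ ≤ s ∧ s₂ ≤ s := con_rel.1 h₁.1
    have hv : v₁ ≤ v := h₁.2
    have k₁ : s₃ ≤ s₁ := h₂.1
    have k₂ : s₄ ≤ s₂ := h₂.2.1
    have k₃ : v₂ ≤ v₁ := h₂.2.2
    -- All copies made by contraction lie below `s`, and can be enlarged to `s` itself.
    have e₁ : s' ≤ s := le_trans (show s' ≤ s₃ from h₃.1) (k₁.trans hs.1)
    have e₂ : s₄ ≤ s := k₂.trans hs.2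
    have e₃ : v₂ ≤ v := k₃.trans hv
    have h₅ : (prom₂ g).rel (s₄, v₂) w := h₃.2
    exact ⟨w, down f h₄ ⟨e₁, le_rfl⟩ le_rfl,
      (prom₂_rel g s v w).1 (down (prom₂ g) h₅ ⟨e₂, e₃⟩ le_rfl)⟩
  · rintro ⟨w, h, h'⟩
    exact ⟨((s, s), v), ⟨con_rel.2 ⟨le_rfl, le_rfl⟩, le_rfl⟩, (s, (s, v)),
      ⟨le_rfl, le_rfl, le_rfl⟩, (s, w), ⟨le_rfl, (prom₂_rel g s v w).2 h'⟩, h⟩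

end Rel

/-! ### The Conway identities -/

section Conway

variable {C : Finset ℕ} {X Z A B : FinScottL.{u}}

/-- The map `promVal g` on parameters is a bisimulation of the two games, since it commutes with
unpainting. -/
theorem fixOp_natural (g : colObj C X ⟶ Z) (f : colObj C Z ⊗ colObj C A ⟶ A) :
    fixOp C X A (prom g ▷ colObj C A ≫ f) = prom g ≫ fixOp C Z A f := by
  refine hom_ext fun s a => (fixOp_rel_iff _ _ _).trans (Iff.trans ?_
    ((prom_comp_rel g _ s a).trans (fixOp_rel_iff _ _ _)).symm)
  constructor
  · intro h
    refine Win.simulate (fun (p : Bang (Box C X) × A) (p' : Bang (Box C Z) × A) =>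
      p' = (promVal g p.1, p.2)) ?_ h rfl
    rintro p _ V rfl ⟨v, hv, hV⟩
    refine ⟨v, (prom_whiskerRight_comp_rel g f p.1 v p.2).1 hv, fun y hy => ⟨_, hV y hy, ?_⟩⟩
    exact Prod.ext (unpaint_promVal g y.col p.1) rfl
  · intro h
    refine Win.simulate (fun (p : Bang (Box C Z) × A) (p' : Bang (Box C X) × A) =>
      p = (promVal g p'.1, p'.2)) ?_ h rfl
    rintro _ p V rfl ⟨v, hv, hV⟩
    refine ⟨v, (prom_whiskerRight_comp_rel g f p.1 v p.2).2 hv, fun y hy => ⟨_, hV y hy, ?_⟩⟩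
    exact Prod.ext (unpaint_promVal g y.col p.1) rfl

/-- The elements which are winning after one step form the promotion of the fixpoint, so the
right-hand side describes the first move. -/
theorem fixOp_fixpoint (f : colObj C X ⊗ colObj C A ⟶ A) :
    fixOp C X A f = con X ≫ colObj C X ◁ prom (fixOp C X A f) ≫ f := by
  refine hom_ext fun s a => (fixOp_rel_iff _ _ _).trans (((win_iff (runGame_mono f)).trans ?_).trans
    ((con_comp_rel _ s a).trans (whiskerLeft_prom_comp_rel _ f s s a)).symm)
  constructor
  · rintro ⟨v, hv, hV⟩
    exact down f hv ⟨le_rfl, fun y hy => ⟨y, mem_promVal.2 ((fixOp_rel_iff _ _ _).2 (hV y hy)),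
      le_rfl⟩⟩ le_rfl
  · intro h
    exact ⟨_, h, fun y hy => (fixOp_rel_iff _ _ _).1 (mem_promVal.1 hy)⟩

/-! ### Dinaturality. -/

/-- The game where `f` and `g` are used alternately. The moves of `g` are those of
the second kind. -/
def starGame (f : colObj C X ⊗ colObj C B ⟶ A) (g : colObj C X ⊗ colObj C A ⟶ B) :
    Bang (Box C X) × (A ⊕ B) → Set (Col C × (Bang (Box C X) × (A ⊕ B))) →
      Set (Col C × (Bang (Box C X) × (A ⊕ B))) → Prop
  | (s, .inl a), V, _ => ∃ w : Bang (Box C B), f.rel (s, w) a ∧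
      ∀ y ∈ w, (y.col, (Bang.unpaint y.col s, Sum.inr y.val)) ∈ V
  | (s, .inr b), _, W => ∃ v : Bang (Box C A), g.rel (s, v) b ∧
      ∀ y ∈ v, (y.col, (Bang.unpaint y.col s, Sum.inl y.val)) ∈ W

theorem starGame_mono (f : colObj C X ⊗ colObj C B ⟶ A) (g : colObj C X ⊗ colObj C A ⟶ B) :
    MoveMono₂ (starGame f g) := by
  rintro ⟨s, a | b⟩ V V' W W' hV hW ⟨w, h, h'⟩
  · exact ⟨w, h, fun y hy => hV (h' y hy)⟩
  · exact ⟨w, h, fun y hy => hW (h' y hy)⟩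

/-- From a position in `A`, a stretch is one move of `f` followed by one of `g`, so unfolding the
inner game twice gives the relation `star f g`. -/
theorem accel_starGame (f : colObj C X ⊗ colObj C B ⟶ A) (g : colObj C X ⊗ colObj C A ⟶ B)
    (s : Bang (Box C X)) (a : A) (W : Set (Col C × (Bang (Box C X) × (A ⊕ B)))) :
    accel (starGame f g) (s, .inl a) W ↔
      runGame (star f g) (s, a) {m | (m.1, (m.2.1, Sum.inl m.2.2)) ∈ W} := by
  have mono := (starGame_mono f g).inner W
  refine (win_iff mono).trans ?_
  constructor
  · rintro ⟨w, hw, hV⟩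
    -- The largest set of answers permitted by `W`, which does not depend on the element that the
    -- opponent picks after `f`.
    refine ⟨Bang.ofSet {y | (y.col, (Bang.unpaint y.col s, Sum.inl y.val)) ∈ W},
      (star_rel _ _ _ _ _).2 ⟨w, hw, fun y hy => ?_⟩,
      fun y hy => (Bang.mem_ofSet {y : Box C A | (y.col, (Bang.unpaint y.col s, Sum.inl y.val)) ∈ W}
        y).1 hy⟩
    obtain ⟨v, hv, hW⟩ := (win_iff mono).1 (hV y hy)
    refine down g hv ⟨le_rfl, fun z hz => ⟨z, Bang.mem_unpaint.2
      ⟨⟨max y.col z.col, z.val⟩, (Bang.mem_ofSet _ _).2 ?_, rfl, le_rfl⟩, le_rfl⟩⟩ le_rfl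
    have := hW z hz
    simp only [bot_sup_eq, Bang.unpaint_unpaint, Set.mem_ofPred_eq] at this
    exact this
  · rintro ⟨v, hv, hV⟩
    obtain ⟨w, hw, hg⟩ := (star_rel _ _ _ _ _).1 hv
    refine ⟨w, hw, fun y hy => (win_iff mono).2 ?_⟩
    -- The elements that land in `v` once painted with the colour of the first half of the stretch.
    let v' : Bang (Box C A) := Bang.ofSet {z | (⟨max y.col z.col, z.val⟩ : Box C A) ∈ v}
    refine ⟨v', down g (hg y hy) ⟨le_rfl, fun z hz => ?_⟩ le_rfl, fun z hz => ?_⟩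
    · obtain ⟨x, hx, hc, hzx⟩ := Bang.mem_unpaint.1 hz
      refine ⟨⟨z.col, x.val⟩, (Bang.mem_ofSet _ _).2 ?_, rfl, hzx⟩
      have e : (⟨max y.col z.col, x.val⟩ : Box C A) = x := Box.ext hc.symm rfl
      exact (congrArg (· ∈ v) e).mpr hx
    · have := hV _ ((Bang.mem_ofSet {z : Box C A | (⟨max y.col z.col, z.val⟩ : Box C A) ∈ v} z).1 hz)
      simp only [bot_sup_eq, Bang.unpaint_unpaint, Set.mem_ofPred_eq] at this ⊢
      exact this

theorem fixOp_star_rel_iff (f : colObj C X ⊗ colObj C B ⟶ A) (g : colObj C X ⊗ colObj C A ⟶ B)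
    (s : Bang (Box C X)) (a : A) :
    (fixOp C X A (star f g)).rel s a ↔ Win (flat (starGame f g)) (s, .inl a) := by
  rw [fixOp_rel_iff, ← win_accel_iff (starGame_mono f g)]
  constructor
  · intro h
    refine Win.simulate (fun p p' => p' = (p.1, Sum.inl p.2)) ?_ h rfl
    rintro p _ V rfl hp
    refine (accel_starGame f g _ _ _).2 (runGame_mono _ (fun m hm => ?_) hp)
    exact ⟨m.2, hm, rfl⟩
  · intro h
    refine Win.simulate (fun p p' => p = (p'.1, Sum.inl p'.2)) ?_ h rfl
    rintro _ p V rfl hp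
    exact runGame_mono _ (fun m hm => ⟨_, hm, rfl⟩) ((accel_starGame f g _ _ _).1 hp)

/-- Once the kinds of moves are forgotten, nothing distinguishes `f` from `g`. -/
theorem win_starGame_swap {f : colObj C X ⊗ colObj C B ⟶ A} {g : colObj C X ⊗ colObj C A ⟶ B}
    {s : Bang (Box C X)} {x : A ⊕ B} (h : Win (flat (starGame f g)) (s, x)) :
    Win (flat (starGame g f)) (s, x.swap) := by
  refine Win.simulate (fun p p' => p' = (p.1, p.2.swap)) ?_ h rfl
  rintro ⟨s, a | b⟩ _ V rfl ⟨w, hw, hV⟩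
  · exact ⟨w, hw, fun y hy => ⟨_, hV y hy, rfl⟩⟩
  · exact ⟨w, hw, fun y hy => ⟨_, hV y hy, rfl⟩⟩

/-- After a first move of `f`, the alternating game is at a position in `B`, where it is the game of
`star g f`. -/
theorem fixOp_dinatural (f : colObj C X ⊗ colObj C B ⟶ A) (g : colObj C X ⊗ colObj C A ⟶ B) :
    fixOp C X A (star f g) = con X ≫ colObj C X ◁ prom (fixOp C X B (star g f)) ≫ f := by
  have swap : ∀ (s : Bang (Box C X)) (b : B), (fixOp C X B (star g f)).rel s b ↔
      Win (flat (starGame f g)) (s, .inr b) := fun s b =>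
    (fixOp_star_rel_iff g f s b).trans ⟨win_starGame_swap, win_starGame_swap⟩
  refine hom_ext fun s a => (fixOp_star_rel_iff _ _ _ _).trans
    (((win_iff (starGame_mono f g).flat).trans ?_).trans
      ((con_comp_rel _ s a).trans (whiskerLeft_prom_comp_rel _ f s s a)).symm)
  constructor
  · rintro ⟨w, hw, hV⟩
    exact down f hw ⟨le_rfl, fun y hy => ⟨y, mem_promVal.2 ((swap _ _).2 (hV y hy)),
      le_rfl⟩⟩ le_rfl
  · intro h
    exact ⟨_, h, fun y hy => (swap _ _).1 (mem_promVal.1 hy)⟩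

/-! ### The diagonal identity. -/

/-- The game of a morphism with two arguments in `A`. The moves in the first argument are
those of the second kind. -/
def diagGame (f : (colObj C X ⊗ colObj C A) ⊗ colObj C A ⟶ A) (p : Bang (Box C X) × A)
    (V W : Set (Col C × (Bang (Box C X) × A))) : Prop :=
  ∃ v w : Bang (Box C A), f.rel ((p.1, w), v) p.2 ∧
    (∀ y ∈ v, (y.col, (Bang.unpaint y.col p.1, y.val)) ∈ V) ∧
    ∀ y ∈ w, (y.col, (Bang.unpaint y.col p.1, y.val)) ∈ W

theorem diagGame_mono (f : (colObj C X ⊗ colObj C A) ⊗ colObj C A ⟶ A) :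
    MoveMono₂ (diagGame f) := fun _ _ _ _ _ hV hW ⟨v, w, h, h₁, h₂⟩ =>
  ⟨v, w, h, fun y hy => hV (h₁ y hy), fun y hy => hW (h₂ y hy)⟩

theorem diag_rel (f : (colObj C X ⊗ colObj C A) ⊗ colObj C A ⟶ A) (s : Bang (Box C X))
    (v : Bang (Box C A)) (a : A) :
    Hom.rel (colObj C X ◁ con A ≫ (α_ (colObj C X) (colObj C A) (colObj C A)).inv ≫ f) (s, v) a ↔
      f.rel ((s, v), v) a := by
  constructor
  · rintro ⟨⟨s₁, v₁, v₂⟩, ⟨h₁, h₂⟩, ⟨⟨s₂, v₃⟩, v₄⟩, ⟨⟨h₃, h₄⟩, h₅⟩, h⟩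
    have hv := con_rel.1 h₂
    have e₁ : s₂ ≤ s := le_trans h₃ h₁
    have e₂ : v₃ ≤ v := le_trans h₄ hv.1
    have e₃ : v₄ ≤ v := le_trans h₅ hv.2
    exact down f h ⟨⟨e₁, e₂⟩, e₃⟩ le_rfl
  · intro h
    exact ⟨(s, (v, v)), ⟨le_rfl, con_rel.2 ⟨le_rfl, le_rfl⟩⟩, ((s, v), v),
      ⟨⟨le_rfl, le_rfl⟩, le_rfl⟩, h⟩

theorem seely_inv_whiskerRight_comp_rel {D E : FinScottL.{u}}
    (f : (colObj C X ⊗ colObj C A) ⊗ D ⟶ E)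
    (s : Bang (Box C X)) (v : Bang (Box C A)) (d : D) (e : E) :
    Hom.rel ((seely X A).inv ▷ D ≫ f) (Bang.merge s v, d) e ↔ f.rel ((s, v), d) e := by
  have hm := (mergeIso (C := C) X A).symm_apply_apply (s, v)
  constructor
  · rintro ⟨⟨q, d'⟩, ⟨h₁, h₂⟩, h⟩
    exact down f h ⟨le_trans h₁ hm.le, h₂⟩ le_rfl
  · intro h
    exact ⟨((s, v), d), ⟨hm.ge, le_rfl⟩, h⟩

/-- The inner fixpoint treats its parameter in `A` as leaves; these are the moves of the second kind
ending the inner game. Their colours from the root of the inner run are the accumulated ones. -/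
theorem accel_diagGame (f : (colObj C X ⊗ colObj C A) ⊗ colObj C A ⟶ A)
    (s : Bang (Box C X)) (a : A) (W : Set (Col C × (Bang (Box C X) × A))) :
    accel (diagGame f) (s, a) W ↔ runGame ((seely X A).hom ≫
      fixOp C (withObj X A) A ((seely X A).inv ▷ colObj C A ≫ f)) (s, a) W := by
  constructor
  · intro h
    let v : Bang (Box C A) := Bang.ofSet {y | (y.col, (Bang.unpaint y.col s, y.val)) ∈ W}
    refine ⟨v, (seely_hom_comp_rel _ (s, v) a).2 ((fixOp_rel_iff _ _ _).2 ?_),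
      fun y hy => (Bang.mem_ofSet {y : Box C A | (y.col, (Bang.unpaint y.col s, y.val)) ∈ W} y).1 hy⟩
    -- The parameter is `s` unpainted by the accumulated colour, but at the start it is `s` and not
    -- `Bang.unpaint ⊥ s`; comparing only further unpaintings makes the invariant exact. For the
    -- same reason `v'` is constrained only by an inequality.
    refine Win.simulate (fun (p : Col C × (Bang (Box C X) × A)) p' =>
      (∀ d, Bang.unpaint d p.2.1 = Bang.unpaint (max p.1 d) s) ∧
      ∃ v', Bang.unpaint p.1 v ≤ v' ∧ p' = (Bang.merge p.2.1 v', p.2.2)) ?_ h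
      ⟨fun d => by rw [bot_sup_eq], v, Bang.unpaint_bot_le v, rfl⟩
    rintro ⟨c, s', b⟩ _ V ⟨hs, v', hv', rfl⟩ ⟨v₂, w, hf, hV, hW⟩
    refine ⟨v₂, (seely_inv_whiskerRight_comp_rel f s' v' v₂ b).2
      (down f hf ⟨⟨le_rfl, fun y hy => ?_⟩, le_rfl⟩ le_rfl), fun y hy => ⟨_, hV y hy, ?_, ?_⟩⟩
    · refine hv' y (Bang.mem_unpaint.2 ⟨⟨max c y.col, y.val⟩, (Bang.mem_ofSet _ _).2 ?_, rfl,
        le_rfl⟩)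
      have := hW y hy
      rw [hs] at this
      exact this
    · intro d
      change Bang.unpaint d (Bang.unpaint y.col s') = _
      rw [Bang.unpaint_unpaint, hs, max_assoc]
    · refine ⟨Bang.unpaint y.col v', ?_, Prod.ext (unpaint_merge _ _ _) rfl⟩
      rw [← Bang.unpaint_unpaint]
      exact Bang.unpaint_mono _ hv'
  · rintro ⟨v, hv, hW⟩
    have h := (fixOp_rel_iff _ _ _).1 ((seely_hom_comp_rel _ (s, v) a).1 hv)
    refine Win.simulate (fun p' (p : Col C × (Bang (Box C X) × A)) =>
      (∀ d, Bang.unpaint d p.2.1 = Bang.unpaint (max p.1 d) s) ∧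
      ∃ v', v' ≤ Bang.unpaint p.1 v ∧ p' = (Bang.merge p.2.1 v', p.2.2)) ?_ h
      ⟨fun d => by rw [bot_sup_eq], v, Bang.le_unpaint_bot v, rfl⟩
    rintro _ ⟨c, s', b⟩ V ⟨hs, v', hv', rfl⟩ ⟨v₂, hf, hV⟩
    -- The elements which, painted with the accumulated colour, belong to `v` and hence are
    -- permitted by `W`.
    let w : Bang (Box C A) := Bang.ofSet {z | (⟨max c z.col, z.val⟩ : Box C A) ∈ v}
    refine ⟨v₂, w, down f ((seely_inv_whiskerRight_comp_rel f s' v' v₂ b).1 hf)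
      ⟨⟨le_rfl, le_trans hv' fun z hz => ?_⟩, le_rfl⟩ le_rfl, fun y hy => ⟨_, hV y hy, ?_, ?_⟩,
      fun y hy => ?_⟩
    · obtain ⟨x, hx, hc, hzx⟩ := Bang.mem_unpaint.1 hz
      refine ⟨⟨z.col, x.val⟩, (Bang.mem_ofSet _ _).2 ?_, rfl, hzx⟩
      have e : (⟨max c z.col, x.val⟩ : Box C A) = x := Box.ext hc.symm rfl
      exact (congrArg (· ∈ v) e).mpr hx
    · intro d
      change Bang.unpaint d (Bang.unpaint y.col s') = _
      rw [Bang.unpaint_unpaint, hs, max_assoc]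
    · refine ⟨Bang.unpaint y.col v', ?_, Prod.ext (unpaint_merge _ _ _) rfl⟩
      rw [← Bang.unpaint_unpaint]
      exact Bang.unpaint_mono _ hv'
    · have := hW _ ((Bang.mem_ofSet {z : Box C A | (⟨max c z.col, z.val⟩ : Box C A) ∈ v} y).1 hy)
      change (max c y.col, (Bang.unpaint y.col s', y.val)) ∈ W
      rw [hs]
      exact this

/-- The two sides are the accelerated and the flat form of `diagGame f`. -/
theorem fixOp_diagonal (f : (colObj C X ⊗ colObj C A) ⊗ colObj C A ⟶ A) :
    fixOp C X A ((seely X A).hom ≫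
      fixOp C (withObj X A) A ((seely X A).inv ▷ colObj C A ≫ f)) =
    fixOp C X A (colObj C X ◁ con A ≫ (α_ (colObj C X) (colObj C A) (colObj C A)).inv ≫ f) := by
  refine hom_ext fun s a => (fixOp_rel_iff _ _ _).trans (Iff.trans ?_ (fixOp_rel_iff _ _ _).symm)
  have h₁ : runGame ((seely X A).hom ≫
      fixOp C (withObj X A) A ((seely X A).inv ▷ colObj C A ≫ f)) = accel (diagGame f) :=
    funext fun p => funext fun W => propext (accel_diagGame f p.1 p.2 W).symm
  have h₂ : runGame (colObj C X ◁ con A ≫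
      (α_ (colObj C X) (colObj C A) (colObj C A)).inv ≫ f) = flat (diagGame f) := by
    refine funext fun p => funext fun V => propext ⟨?_, ?_⟩
    · rintro ⟨v, hv, hV⟩
      exact ⟨v, v, (diag_rel f _ _ _).1 hv, hV, hV⟩
    · rintro ⟨v, w, h, hv, hw⟩
      -- On the diagonal both arguments coincide; by monotonicity each may be enlarged to the union.
      let x : Bang (Box C A) := Bang.ofSet {y | y ∈ v ∨ y ∈ w}
      refine ⟨x, (diag_rel f _ _ _).2 (down f h
        ⟨⟨le_rfl, fun y hy => ⟨y, (Bang.mem_ofSet _ _).2 (Or.inr hy), le_rfl⟩⟩,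
          fun y hy => ⟨y, (Bang.mem_ofSet _ _).2 (Or.inl hy), le_rfl⟩⟩ le_rfl), fun y hy => ?_⟩
      exact ((Bang.mem_ofSet {y | y ∈ v ∨ y ∈ w} y).1 hy).elim (hv y) (hw y)
  rw [h₁, h₂]
  exact win_accel_iff (diagGame_mono f)

theorem isConwayOperator_fixOp (C : Finset ℕ) : IsConwayOperator.{u} C (fixOp C) where
  natural := fixOp_natural
  fixpoint := fixOp_fixpoint
  dinatural := fixOp_dinatural
  diagonal := fixOp_diagonal

end Conway

end FinScottL

namespace FinScottL

/-! ### The fixpoint operator on the Kleisli category -/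

section Kleisli

open CartesianMonoidalCategory

variable {C : Finset ℕ}

/-- The promotion of a Kleisli identity or projection produces `Bang.unpaint ⊥ s`, which no morphism
distinguishes from `s`. -/
theorem rel_unpaint_bot {A D : FinScottL.{u}} (R : colObj C A ⟶ D) {s : Bang (Box C A)} {d : D} :
    R.rel (Bang.unpaint ⊥ s) d ↔ R.rel s d :=
  ⟨fun h => down R h (Bang.unpaint_bot_le s) le_rfl,
    fun h => down R h (Bang.le_unpaint_bot s) le_rfl⟩

theorem promVal_pair {T A B : FinScottL.{u}} (f : colObj C T ⟶ A) (g : colObj C T ⟶ B)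
    (s : Bang (Box C T)) :
    promVal (FinScottL.pair f g) s = Bang.merge (promVal f s) (promVal g s) := by
  refine Bang.ext ?_
  rintro ⟨c, a | b⟩
  · exact mem_promVal.trans ((mem_promVal (g := f) (s := s) (y := ⟨c, a⟩)).symm.trans
      Bang.inl_mem_merge.symm)
  · exact mem_promVal.trans ((mem_promVal (g := g) (s := s) (y := ⟨c, b⟩)).symm.trans
      Bang.inr_mem_merge.symm)

theorem promVal_der {A : FinScottL.{u}} (s : Bang (Box C A)) :
    promVal (colDer C A) s = Bang.unpaint ⊥ s := by
  refine Bang.ext fun z => ?_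
  rw [mem_promVal, colDer_rel, Bang.mem_unpaint]
  constructor
  · rintro ⟨x, hx, hc, hzx⟩
    obtain ⟨y, hy, hyx, hxy⟩ := Bang.mem_unpaint.1 hx
    exact ⟨y, hy, by rw [hyx, hc, sup_bot_eq, bot_sup_eq], hzx.trans hxy⟩
  · rintro ⟨y, hy, hyz, hzy⟩
    exact ⟨⟨⊥, z.val⟩, Bang.mem_unpaint.2 ⟨y, hy, by rw [hyz, sup_bot_eq, bot_sup_eq], hzy⟩,
      rfl, le_rfl⟩

theorem promVal_der_proj₁ {A B : FinScottL.{u}} (s : Bang (Box C A)) (t : Bang (Box C B)) :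
    promVal (colDer C (withObj A B) ≫ proj₁ A B) (Bang.merge s t) = Bang.unpaint ⊥ s := by
  refine Bang.ext fun z => (mem_promVal.trans (comp_proj₁_rel _ _ _)).trans ?_
  refine Iff.trans (b := (⟨z.col, Sum.inl z.val⟩ : Box C (A ⊕ B)) ∈
    Bang.unpaint ⊥ (Bang.merge s t)) ?_ ?_
  · exact (mem_promVal (g := colDer C (withObj A B)) (s := Bang.merge s t)
      (y := ⟨z.col, Sum.inl z.val⟩)).symm.trans (iff_of_eq (congrArg (_ ∈ ·) (promVal_der _)))
  · rw [unpaint_merge]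
    exact Bang.inl_mem_merge

theorem promVal_der_proj₂ {A B : FinScottL.{u}} (s : Bang (Box C A)) (t : Bang (Box C B)) :
    promVal (colDer C (withObj A B) ≫ proj₂ A B) (Bang.merge s t) = Bang.unpaint ⊥ t := by
  refine Bang.ext fun z => (mem_promVal.trans (comp_proj₂_rel _ _ _)).trans ?_
  refine Iff.trans (b := (⟨z.col, Sum.inr z.val⟩ : Box C (A ⊕ B)) ∈
    Bang.unpaint ⊥ (Bang.merge s t)) ?_ ?_
  · exact (mem_promVal (g := colDer C (withObj A B)) (s := Bang.merge s t)
      (y := ⟨z.col, Sum.inr z.val⟩)).symm.trans (iff_of_eq (congrArg (_ ∈ ·) (promVal_der _)))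
  · rw [unpaint_merge]
    exact Bang.inr_mem_merge

theorem promVal_comp {X A B : FinScottL.{u}} (f : colObj C X ⟶ A) (g : colObj C A ⟶ B)
    (s : Bang (Box C X)) : promVal (prom f ≫ g) s = promVal g (promVal f s) := by
  refine Bang.ext fun z => ?_
  rw [mem_promVal, prom_comp_rel, mem_promVal, unpaint_promVal]

theorem merge_unpaint_bot_rel {A B D : FinScottL.{u}} (R : colObj C (withObj A B) ⟶ D)
    {s : Bang (Box C A)} {t : Bang (Box C B)} {d : D} :
    R.rel (Bang.merge (Bang.unpaint ⊥ s) (Bang.unpaint ⊥ t)) d ↔ R.rel (Bang.merge s t) d :=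
  (iff_of_eq (congrArg (fun w => R.rel w d) (unpaint_merge ⊥ s t).symm)).trans (rel_unpaint_bot R)

theorem merge_unpaint_bot_left_rel {A B D : FinScottL.{u}} (R : colObj C (withObj A B) ⟶ D)
    {s : Bang (Box C A)} {t : Bang (Box C B)} {d : D} :
    R.rel (Bang.merge (Bang.unpaint ⊥ s) t) d ↔ R.rel (Bang.merge s t) d := by
  refine (merge_unpaint_bot_rel R).symm.trans (Iff.trans ?_ (merge_unpaint_bot_rel R))
  rw [Bang.unpaint_unpaint, bot_sup_eq]

theorem prom_pair_comp_rel {T A B D : FinScottL.{u}} (f : colObj C T ⟶ A) (g : colObj C T ⟶ B)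
    (R : colObj C (withObj A B) ⟶ D) (s : Bang (Box C T)) (d : D) :
    Hom.rel (prom (FinScottL.pair f g) ≫ R) s d ↔
      R.rel (Bang.merge (promVal f s) (promVal g s)) d :=
  (prom_comp_rel _ R s d).trans (iff_of_eq (congrArg (fun w => R.rel w d) (promVal_pair f g s)))

/-- Translation of whiskering by a Kleisli morphism into the linear form used in naturality. -/
theorem seely_prom_whisker {X Z A D : FinScottL.{u}} (g : colObj C X ⟶ Z)
    (f : colObj C (withObj Z A) ⟶ D) :
    (seely X A).hom ≫ prom (FinScottL.pair (prom (colDer C (withObj X A) ≫ proj₁ X A) ≫ g)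
      (colDer C (withObj X A) ≫ proj₂ X A)) ≫ f =
      prom g ▷ colObj C A ≫ (seely Z A).hom ≫ f := by
  refine hom_ext fun ⟨s, v⟩ d => ((seely_hom_comp_rel _ (s, v) d).trans
    (prom_pair_comp_rel _ _ f _ d)).trans (Iff.trans ?_
      ((prom_whiskerRight_comp_rel g _ s v d).trans
        (seely_hom_comp_rel f (promVal g s, v) d)).symm)
  refine Iff.trans (iff_of_eq (congrArg (fun w => f.rel w d) ?_)) (merge_unpaint_bot_rel f)
  exact congrArg₂ Bang.merge ((promVal_comp _ g _).trans
    ((congrArg (promVal g) (promVal_der_proj₁ s v)).trans (unpaint_promVal g ⊥ s).symm))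
    (promVal_der_proj₂ s v)

/-- Pairing with the identity in the Kleisli category is contraction followed by promotion; this
carries the fixpoint and dinaturality identities over. -/
theorem con_whisker_seely {X A D : FinScottL.{u}} (g : colObj C X ⟶ A)
    (f : colObj C (withObj X A) ⟶ D) :
    con X ≫ colObj C X ◁ prom g ≫ (seely X A).hom ≫ f =
      prom (FinScottL.pair (colDer C X) g) ≫ f := by
  refine hom_ext fun s d => (((con_comp_rel _ s d).trans
    (whiskerLeft_prom_comp_rel g _ s s d)).trans (seely_hom_comp_rel f (s, promVal g s) d)).trans
      (Iff.trans ?_ (prom_pair_comp_rel _ _ f s d).symm)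
  exact (merge_unpaint_bot_left_rel f).symm.trans
    (iff_of_eq (congrArg (fun w => f.rel (Bang.merge w (promVal g s)) d) (promVal_der s).symm))

theorem star_seely {X A B : FinScottL.{u}} (f : colObj C (withObj X B) ⟶ A)
    (g : colObj C (withObj X A) ⟶ B) :
    (seely X A).hom ≫ prom (FinScottL.pair (colDer C (withObj X A) ≫ proj₁ X A) g) ≫ f =
      star ((seely X B).hom ≫ f) ((seely X A).hom ≫ g) := by
  refine hom_ext fun ⟨s, v⟩ a => ((seely_hom_comp_rel _ (s, v) a).trans
    (prom_pair_comp_rel _ _ f _ a)).trans (Iff.trans ?_ (star_rel _ _ s v a).symm)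
  have e : promVal (colDer C (withObj X A) ≫ proj₁ X A) (Bang.merge s v) = Bang.unpaint ⊥ s :=
    promVal_der_proj₁ s v
  have hg : ∀ y : Box C B, y ∈ promVal g (Bang.merge s v) ↔
      Hom.rel ((seely X A).hom ≫ g) (Bang.unpaint y.col s, Bang.unpaint y.col v) y.val := fun y =>
    mem_promVal.trans (Iff.trans
      (iff_of_eq (congrArg (fun w => g.rel w y.val) (unpaint_merge y.col s v)))
      (seely_hom_comp_rel g (Bang.unpaint y.col s, Bang.unpaint y.col v) y.val).symm)
  refine (iff_of_eq (congrArg (fun w => f.rel (Bang.merge w (promVal g (Bang.merge s v))) a) e)).trans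
    ((merge_unpaint_bot_left_rel f).trans ?_)
  refine (seely_hom_comp_rel f (s, promVal g (Bang.merge s v)) a).symm.trans ?_
  constructor
  · intro h
    exact ⟨_, h, fun y hy => (hg y).1 hy⟩
  · rintro ⟨w, h, hw⟩
    exact down _ h ⟨le_rfl, fun y hy => ⟨y, (hg y).2 (hw y hy), le_rfl⟩⟩ le_rfl

theorem seely_whiskerRight_comp_rel {X A D E : FinScottL.{u}}
    (f : colObj C (withObj X A) ⊗ D ⟶ E)
    (s : Bang (Box C X)) (v : Bang (Box C A)) (d : D) (e : E) :
    Hom.rel ((seely X A).hom ▷ D ≫ f) ((s, v), d) e ↔ f.rel (Bang.merge s v, d) e := by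
  constructor
  · rintro ⟨⟨q, d'⟩, ⟨h₁, h₂⟩, h⟩
    exact down f h ⟨h₁, h₂⟩ le_rfl
  · intro h
    exact ⟨(Bang.merge s v, d), ⟨(le_rfl : Bang.merge s v ≤ Bang.merge s v), le_rfl⟩, h⟩

theorem diag_seely {X A : FinScottL.{u}} (f : colObj C (withObj (withObj X A) A) ⟶ A) :
    (seely X A).hom ≫ prom (FinScottL.pair (colDer C (withObj X A))
      (colDer C (withObj X A) ≫ proj₂ X A)) ≫ f =
    colObj C X ◁ con A ≫ (α_ (colObj C X) (colObj C A) (colObj C A)).inv ≫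
      (seely X A).hom ▷ colObj C A ≫ (seely (withObj X A) A).hom ≫ f := by
  refine hom_ext fun ⟨s, v⟩ a => ((seely_hom_comp_rel _ (s, v) a).trans
    (prom_pair_comp_rel _ _ f _ a)).trans (Iff.trans ?_ ((diag_rel _ s v a).trans
      ((seely_whiskerRight_comp_rel _ s v v a).trans
        (seely_hom_comp_rel f (Bang.merge s v, v) a))).symm)
  refine Iff.trans (iff_of_eq (congrArg (fun w => f.rel w a) ?_)) (merge_unpaint_bot_rel f)
  exact congrArg₂ Bang.merge (promVal_der _) (promVal_der_proj₂ s v)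

theorem kleisli_comp_of {X A B : Cokleisli (colBang.{u} C)} (f : X ⟶ A) (g : A ⟶ B) :
    (f ≫ g).of = prom f.of ≫ g.of := (Category.assoc _ _ _).symm

theorem kleisliFix_natural {X Z A : Cokleisli (colBang.{u} C)} (g : X ⟶ Z) (f : Z ⊗ A ⟶ A) :
    kleisliFix C X A (g ▷ A ≫ f) = g ≫ kleisliFix C Z A f := by
  refine Cokleisli.hom_ext _ ?_
  refine Eq.trans ?_ ((fixOp_natural g.of ((seely Z.of A.of).hom ≫ f.of)).trans
    (kleisli_comp_of g (kleisliFix C Z A f)).symm)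
  refine congrArg (fixOp C X.of A.of) (Eq.trans ?_ (seely_prom_whisker g.of f.of))
  -- `lift` unfolds to `FinScottL.pair` by definition, which makes the whiskering explicit.
  have e : g ▷ A = lift (fst X A ≫ g) (snd X A) := by ext <;> simp
  have e' : (g ▷ A).of = FinScottL.pair (prom (colDer C (withObj X.of A.of) ≫ proj₁ X.of A.of) ≫
      g.of) (colDer C (withObj X.of A.of) ≫ proj₂ X.of A.of) :=
    (congrArg Cokleisli.Hom.of e).trans
      (congrArg (fun h => FinScottL.pair h (snd X A).of) (kleisli_comp_of (fst X A) g))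
  exact congrArg ((seely X.of A.of).hom ≫ ·) ((kleisli_comp_of (g ▷ A) f).trans
    (congrArg (fun h => prom h ≫ f.of) e'))

theorem kleisliFix_fixpoint {X A : Cokleisli (colBang.{u} C)} (f : X ⊗ A ⟶ A) :
    kleisliFix C X A f = lift (𝟙 X) (kleisliFix C X A f) ≫ f := by
  refine Cokleisli.hom_ext _ ?_
  exact (fixOp_fixpoint _).trans ((con_whisker_seely _ f.of).trans
    (kleisli_comp_of (lift (𝟙 X) (kleisliFix C X A f)) f).symm)

theorem kleisliFix_star {X A B : Cokleisli (colBang.{u} C)} (f : X ⊗ B ⟶ A) (g : X ⊗ A ⟶ B) :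
    (kleisliFix C X A (lift (fst X A) g ≫ f)).of =
      fixOp C X.of A.of (star ((seely X.of B.of).hom ≫ f.of) ((seely X.of A.of).hom ≫ g.of)) :=
  congrArg (fixOp C X.of A.of) (Eq.trans
    (congrArg ((seely X.of A.of).hom ≫ ·) (kleisli_comp_of (lift (fst X A) g) f))
    (star_seely f.of g.of))

theorem kleisliFix_dinatural {X A B : Cokleisli (colBang.{u} C)} (f : X ⊗ B ⟶ A)
    (g : X ⊗ A ⟶ B) :
    kleisliFix C X A (lift (fst X A) g ≫ f) =
      lift (𝟙 X) (kleisliFix C X B (lift (fst X B) f ≫ g)) ≫ f := by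
  refine Cokleisli.hom_ext _ ?_
  refine (kleisliFix_star f g).trans ((fixOp_dinatural _ _).trans
    ((con_whisker_seely _ f.of).trans ?_))
  refine Eq.trans ?_ (kleisli_comp_of (lift (𝟙 X) (kleisliFix C X B (lift (fst X B) f ≫ g))) f).symm
  exact congrArg (fun h => prom (FinScottL.pair (colDer C X.of) h) ≫ f.of) (kleisliFix_star g f).symm

theorem kleisliFix_diagonal {X A : Cokleisli (colBang.{u} C)} (f : (X ⊗ A) ⊗ A ⟶ A) :
    kleisliFix C X A (kleisliFix C (X ⊗ A) A f) =
      kleisliFix C X A (lift (𝟙 (X ⊗ A)) (snd X A) ≫ f) := by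
  refine Cokleisli.hom_ext _ ?_
  -- Both Seely isomorphisms are absorbed into `f'`; the inverse in the linear diagonal identity
  -- then cancels the inner one.
  let f' : (colObj C X.of ⊗ colObj C A.of) ⊗ colObj C A.of ⟶ A.of :=
    (seely X.of A.of).hom ▷ colObj C A.of ≫ (seely (withObj X.of A.of) A.of).hom ≫ f.of
  have h : (seely X.of A.of).inv ▷ colObj C A.of ≫ f' =
      (seely (withObj X.of A.of) A.of).hom ≫ f.of := by
    rw [← Category.assoc, ← comp_whiskerRight, Iso.inv_hom_id, id_whiskerRight, Category.id_comp]
  have e := fixOp_diagonal f'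
  rw [h] at e
  refine Eq.trans e (congrArg (fixOp C X.of A.of) ?_)
  refine (diag_seely f.of).symm.trans ?_
  exact congrArg ((seely X.of A.of).hom ≫ ·)
    (kleisli_comp_of (lift (𝟙 (X ⊗ A)) (snd X A)) f).symm

theorem isCartesianConwayOperator_kleisliFix (C : Finset ℕ) :
    IsCartesianConwayOperator (kleisliFix.{u} C) where
  natural := kleisliFix_natural
  fixpoint := kleisliFix_fixpoint
  dinatural := kleisliFix_dinatural
  diagonal := kleisliFix_diagonal

end Kleisli

end FinScottL

/-! ### Soundness of the interpretation of the `λY`-calculus -/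

namespace LambdaY

open CartesianMonoidalCategory

section

variable {K : Type u} [Category.{v} K] [CartesianMonoidalCategory K] [MonoidalClosed K]
  {Y : ∀ X A : K, (X ⊗ A ⟶ A) → (X ⟶ A)}

/-- The parameter of the combinator plays no role, so by naturality of `Y` the combinator is stable
under change of context. -/
theorem fixSem_natural
    (natural : ∀ {X Z A : K} (g : X ⟶ Z) (f : Z ⊗ A ⟶ A), Y X A (g ▷ A ≫ f) = g ≫ Y Z A f)
    {X Z : K} (g : X ⟶ Z) (A : K) : g ≫ fixSem Y Z A = fixSem Y X A := by
  rw [fixSem, fixSem, ← MonoidalClosed.curry_natural_left, ← natural, ← Category.assoc]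
  congr 3
  ext <;> simp

theorem lift_curry_ev {X A B : K} (s : X ⟶ A) (t : A ⊗ X ⟶ B) :
    lift s (MonoidalClosed.curry t) ≫ (ihom.ev A).app B = lift s (𝟙 X) ≫ t := by
  have h : lift s (MonoidalClosed.curry t) = lift s (𝟙 X) ≫ A ◁ MonoidalClosed.curry t := by simp
  rw [h, Category.assoc, MonoidalClosed.whiskerLeft_curry_ihom_ev_app]

theorem lift_comp_ev {X Z A B : K} (ρ : X ⟶ Z) (s : Z ⟶ A) (t : Z ⟶ (ihom A).obj B) :
    lift (ρ ≫ s) (ρ ≫ t) ≫ (ihom.ev A).app B = ρ ≫ lift s t ≫ (ihom.ev A).app B := by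
  rw [← comp_lift, Category.assoc]

theorem curry_lift_ev {X A B : K} (t : X ⟶ (ihom A).obj B) :
    MonoidalClosed.curry (lift (fst A X) (snd A X ≫ t) ≫ (ihom.ev A).app B) = t := by
  refine Eq.trans ?_ (MonoidalClosed.curry_uncurry t)
  rw [MonoidalClosed.uncurry_eq]
  congr 2
  ext <;> simp

variable {O : K} {S : Type w} {ty : S → Ty} {κ : ∀ c, 𝟙_ K ⟶ (ty c).sem O}

/-- Stated for any `ρ` which interprets `r` on variables, so that the induction passes under
binders. It is needed before `sem_sub` because substitutions are weakened there. -/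
theorem sem_ren
    (natural : ∀ {X Z A : K} (g : X ⟶ Z) (f : Z ⊗ A ⟶ A), Y X A (g ▷ A ≫ f) = g ≫ Y Z A f)
    {Γ : List Ty} {τ : Ty} (t : Tm ty Γ τ) : ∀ {Δ : List Ty} (r : ∀ τ, Var Γ τ → Var Δ τ)
    (ρ : ctxSem O Δ ⟶ ctxSem O Γ), (∀ τ x, (r τ x).sem O = ρ ≫ x.sem O) →
      (t.ren r).sem Y O κ = ρ ≫ t.sem Y O κ := by
  induction t with
  | var x => exact fun r ρ h => h _ x
  | const c =>
    intro Δ r ρ h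
    simp only [Tm.ren, Tm.sem]
    rw [← Category.assoc]
    congr 1
    exact toUnit_unique _ _
  | lam t ih =>
    intro Δ r ρ h
    refine Eq.trans (congrArg MonoidalClosed.curry ?_)
      (MonoidalClosed.curry_natural_left ρ (t.sem Y O κ))
    refine ih (liftRen r) (_ ◁ ρ) fun τ x => ?_
    cases x with
    | zero => exact (whiskerLeft_fst _ _).symm
    | succ x =>
      refine (congrArg (snd _ _ ≫ ·) (h τ x)).trans ?_
      exact (whiskerLeft_snd_assoc _ _ _).symm
  | app t s iht ihs =>
    intro Δ r ρ h
    exact (congrArg₂ (fun a b => lift a b ≫ (ihom.ev _).app _) (ihs r ρ h) (iht r ρ h)).trans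
      (lift_comp_ev ρ _ _)
  | fix σ => exact fun r ρ h => (fixSem_natural natural ρ _).symm

theorem sem_wk
    (natural : ∀ {X Z A : K} (g : X ⟶ Z) (f : Z ⊗ A ⟶ A), Y X A (g ▷ A ≫ f) = g ≫ Y Z A f)
    {Γ : List Ty} {σ τ : Ty} (t : Tm ty Γ τ) :
    (t.wk (σ := σ)).sem Y O κ = snd (σ.sem O) (ctxSem O Γ) ≫ t.sem Y O κ :=
  sem_ren natural t _ _ fun _ _ => rfl

theorem sem_sub
    (natural : ∀ {X Z A : K} (g : X ⟶ Z) (f : Z ⊗ A ⟶ A), Y X A (g ▷ A ≫ f) = g ≫ Y Z A f)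
    {Γ : List Ty} {τ : Ty} (t : Tm ty Γ τ) : ∀ {Δ : List Ty} (r : ∀ τ, Var Γ τ → Tm ty Δ τ)
    (ρ : ctxSem O Δ ⟶ ctxSem O Γ), (∀ τ x, (r τ x).sem Y O κ = ρ ≫ x.sem O) →
      (t.sub r).sem Y O κ = ρ ≫ t.sem Y O κ := by
  induction t with
  | var x => exact fun r ρ h => h _ x
  | const c =>
    intro Δ r ρ h
    simp only [Tm.sub, Tm.sem]
    rw [← Category.assoc]
    congr 1
    exact toUnit_unique _ _
  | lam t ih =>
    intro Δ r ρ h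
    refine Eq.trans (congrArg MonoidalClosed.curry ?_)
      (MonoidalClosed.curry_natural_left ρ (t.sem Y O κ))
    refine ih (liftSub r) (_ ◁ ρ) fun τ x => ?_
    cases x with
    | zero => exact (whiskerLeft_fst _ _).symm
    | succ x =>
      refine (sem_wk natural _).trans ((congrArg (snd _ _ ≫ ·) (h τ x)).trans ?_)
      exact (whiskerLeft_snd_assoc _ _ _).symm
  | app t s iht ihs =>
    intro Δ r ρ h
    exact (congrArg₂ (fun a b => lift a b ≫ (ihom.ev _).app _) (ihs r ρ h) (iht r ρ h)).trans
      (lift_comp_ev ρ _ _)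
  | fix σ => exact fun r ρ h => (fixSem_natural natural ρ _).symm

theorem sem_single {Γ : List Ty} {σ : Ty} (s : Tm ty Γ σ) (τ : Ty) (x : Var (σ :: Γ) τ) :
    (single s τ x).sem Y O κ = lift (s.sem Y O κ) (𝟙 (ctxSem O Γ)) ≫ x.sem O := by
  cases x with
  | zero => exact (lift_fst _ _).symm
  | succ x => exact ((lift_snd_assoc _ _ _).trans (Category.id_comp _)).symm

/-- By naturality, the combinator applied to `t` is `Y` of the uncurried `t`, and the fixpoint
identity unfolds it once. -/
theorem fixSem_unroll
    (natural : ∀ {X Z A : K} (g : X ⟶ Z) (f : Z ⊗ A ⟶ A), Y X A (g ▷ A ≫ f) = g ≫ Y Z A f)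
    (fixpoint : ∀ {X A : K} (f : X ⊗ A ⟶ A), Y X A f = lift (𝟙 X) (Y X A f) ≫ f)
    {X A : K} (t : X ⟶ (ihom A).obj A) :
    lift t (fixSem Y X A) ≫ (ihom.ev _).app A =
      lift (lift t (fixSem Y X A) ≫ (ihom.ev _).app A) t ≫ (ihom.ev A).app A := by
  have h : lift t (fixSem Y X A) ≫ (ihom.ev _).app A =
      Y X A (lift (snd X A) (fst X A ≫ t) ≫ (ihom.ev A).app A) := by
    rw [fixSem, lift_curry_ev, ← natural, ← Category.assoc]
    congr 2
    ext <;> simp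
  rw [h]
  conv_lhs => rw [fixpoint]
  rw [← Category.assoc]
  congr 1
  ext <;> simp

/-- A cartesian closed category with an operator which is natural in its parameter and
computes fixpoints is a model of the `λY`-calculus. -/
theorem isModel_of_natural_of_fixpoint
    (natural : ∀ {X Z A : K} (g : X ⟶ Z) (f : Z ⊗ A ⟶ A), Y X A (g ▷ A ≫ f) = g ≫ Y Z A f)
    (fixpoint : ∀ {X A : K} (f : X ⊗ A ⟶ A), Y X A f = lift (𝟙 X) (Y X A f) ≫ f) :
    IsModel.{u, v, w} Y := by
  intro O S ty κ Γ τ t s h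
  induction h with
  | refl t => rfl
  | symm _ ih => exact ih.symm
  | trans _ _ ih ih' => exact ih.trans ih'
  | lam _ ih => exact congrArg MonoidalClosed.curry ih
  | app _ _ ih ih' =>
    exact congrArg₂ (fun a b => lift a b ≫ (ihom.ev _).app _) ih' ih
  | beta t s =>
    rw [sem_sub natural t _ _ (sem_single s)]
    exact lift_curry_ev _ _
  | eta t =>
    exact (congrArg (fun a => MonoidalClosed.curry (lift (fst _ _) a ≫ (ihom.ev _).app _))
      (sem_wk natural t)).trans (curry_lift_ev _)
  | delta t => exact fixSem_unroll natural fixpoint _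

end

end LambdaY

theorem mainTheorem5 (C : Finset ℕ) :
    FinScottL.IsConwayOperator.{u} C (FinScottL.fixOp C) ∧
      IsCartesianConwayOperator (FinScottL.kleisliFix.{u} C) ∧
      LambdaY.IsModel.{u + 1, u, w} (FinScottL.kleisliFix.{u} C) :=
  ⟨FinScottL.isConwayOperator_fixOp C, FinScottL.isCartesianConwayOperator_kleisliFix C,
    LambdaY.isModel_of_natural_of_fixpoint FinScottL.kleisliFix_natural
      FinScottL.kleisliFix_fixpoint⟩
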